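/- Let $\mathcal X\subseteq\mathbb R^d$ be measurable, $p$ a probability distribution on $\mathcal X$, $f:\mathcal X\to\mathcal Y$ a teacher, $\mathcal G$ a class of functions $\mathcal X\to\mathcal Y$ and $\mathrm{dist}:\mathcal Y\times\mathcal Y\to\mathbb R$ with $0\le \mathrm{dist}(f(x),g(x))\le 1$ for all $x\in\mathcal X$, $g\in\mathcal G$. Write $D(f,g,p)=\mathbb E_{x\sim p}[\mathrm{dist}(f(x),g(x))]$, and, for a finite family of points (repetitions counted), let $D_{\mathrm{emp}}(f,g,\cdot)$ be the average of $\mathrm{dist}(f(x),g(x))$ over these points. Let $V\ge 1$ be an integer that is at least the VC dimension of the loss class $\{x\mapsto \mathrm{dist}(f(x),g(x)) : g\in\mathcal G\}$ (i.e. the VC dimension of the class of subgraphs $\{(x,r): r<\mathrm{dist}(f(x),g(x))\}$). Given conditional distributions of every feature $x^i$ given the remaining features $x^{-i}$ (such that resampling a feature of a point of $\mathcal X$ stays in $\mathcal X$ almost surely), a step of the Gibbs sampler replaces one feature by a draw from its conditional distribution; the order in which features are updated may be random, with any law. Let $T_q^kp$ be the distribution after $k$ such steps started from $p$, and $$\Delta_k=\|T_q^kp-p\|_{TV},\qquad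 \|\nu-\mu\|_{TV}=2\sup_A|\nu(A)-\mu(A)|.$$ Let $X_n=(x_1,\dots,x_n)$, $n\ge1$, with $x_i\sim p$, and $X_n'=(x_1',\dots,x_n')$ with $x_i'\sim T_q^kp$, where the pairs $(x_1,x_1'),\dots,(x_n,x_n')$ are independent of each other; $x_i'$ may depend on $x_i$ in any way (in particular, $x_i'$ may be the result of $k$ Gibbs steps started at the training point $x_i$, or may be independent of $x_i$). Let the student $g^*\in\mathcal G$ be a (measurable) function of the data that minimizes $D_{\mathrm{emp}}(f,g,X_n\cup X_n')$ over $g\in\mathcal G$ almost surely. Then there is an absolute constant $c>0$ (independent of all of the above) such that for every $\delta\in(0,1)$, with probability at least $1-\delta$, $$D(f,g^*,p)\le D_{\mathrm{emp}}(f,g^*,X_n\cup X_n')+\sqrt{\frac{4V(c+\Delta_k)-\log\delta}{n}}+\Delta_k .$$ -/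

import Mathlib

open MeasureTheory ProbabilityTheory

noncomputable section

namespace Distill

/-! ### Distances between teacher and student -/

/-- The population distance `D(f, g, p) = 𝔼_{x ∼ p} [dist (f x) (g x)]`. -/
def popDist {𝒳 𝒴 : Type*} [MeasurableSpace 𝒳] (dist : 𝒴 → 𝒴 → ℝ) (f g : 𝒳 → 𝒴)
    (p : Measure 𝒳) : ℝ :=
  ∫ x, dist (f x) (g x) ∂p

/-- The empirical distance of `f` and `g` on a finite family of points `x` (repetitions counted). -/
def empDist {𝒳 𝒴 ι : Type*} [Fintype ι] (dist : 𝒴 → 𝒴 → ℝ) (f g : 𝒳 → 𝒴) (x : ι → 𝒳) : ℝ :=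
  (∑ i, dist (f (x i)) (g (x i))) / Fintype.card ι

/-- The total-variation norm `‖ν - μ‖ = 2 sup {|ν(A) - μ(A)| : A measurable}`. -/
def tvNorm {𝒳 : Type*} [MeasurableSpace 𝒳] (ν μ : Measure 𝒳) : ℝ :=
  2 * ⨆ A : {A : Set 𝒳 // MeasurableSet A}, |ν.real A.1 - μ.real A.1|

/-! ### Complexity of a class of real functions -/

/-- `F` shatters some `m` points: there are points `x i` and levels `r i` such that every pattern
of "above the level" / "not above the level" is realized by a member of `F`. -/
def ShattersSome {𝒳 : Type*} (F : Set (𝒳 → ℝ)) (m : ℕ) : Prop :=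
  ∃ (x : Fin m → 𝒳) (r : Fin m → ℝ), ∀ s : Set (Fin m), ∃ h ∈ F, ∀ i, r i < h (x i) ↔ i ∈ s

/-- The VC dimension of a class of real functions, that is, of the class of their subgraphs
`{(x, r) | r < h x}` (also called the pseudo-dimension). -/
def vcDim {𝒳 : Type*} (F : Set (𝒳 → ℝ)) : ℕ∞ :=
  ⨆ (m : ℕ) (_ : ShattersSome F m), (m : ℕ∞)

/-- The class `{x ↦ dist (f x) (g x) | g ∈ G}`. -/
def lossClass {𝒳 𝒴 : Type*} (dist : 𝒴 → 𝒴 → ℝ) (f : 𝒳 → 𝒴) (G : Set (𝒳 → 𝒴)) : Set (𝒳 → ℝ) :=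
  (fun g x => dist (f x) (g x)) '' G

/-! ### The Gibbs sampler -/

/-- (Estimated) conditional distributions of each feature `i` given all the other features, for
data points in `𝒳 ⊆ ℝ^d`. They need not be the conditionals of a common joint distribution.
Resampling a feature of a point of `𝒳` almost surely gives a point of `𝒳`. -/
structure Conditionals {d : ℕ} (𝒳 : Set (Fin d → ℝ)) where
  kernel : ∀ i : Fin d, Kernel ({j : Fin d // j ≠ i} → ℝ) ℝ
  isMarkov : ∀ i, IsMarkovKernel (kernel i)
  update_mem : ∀ (i : Fin d) (x : 𝒳),
    ∀ᵐ y ∂(kernel i (fun j => x.1 j.1)), Function.update x.1 i y ∈ 𝒳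

variable {d : ℕ} {𝒳 : Set (Fin d → ℝ)}

/-- One step of the Gibbs sampler, at feature `i`: the `i`-th coordinate of `x` is replaced by a
draw from the conditional distribution given the other coordinates of `x`. -/
def gibbsStep (h𝒳 : MeasurableSet 𝒳) (Q : Conditionals 𝒳) (i : Fin d) : Kernel 𝒳 𝒳 :=
  (Kernel.map
      (Kernel.id ×ₖ (Q.kernel i).comap (fun (x : 𝒳) (j : {j : Fin d // j ≠ i}) => x.1 j.1)
        (measurable_pi_lambda _ fun j => (measurable_pi_apply j.1).comp measurable_subtype_coe))
      (fun z : 𝒳 × ℝ => Function.update z.1.1 i z.2)).comapRight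
    (MeasurableEmbedding.subtype_coe h𝒳)

/-- Gibbs steps at the features of a list, the head of the list being the first step. -/
def gibbsPath (h𝒳 : MeasurableSet 𝒳) (Q : Conditionals 𝒳) : List (Fin d) → Kernel 𝒳 𝒳
  | [] => Kernel.id
  | i :: l => gibbsPath h𝒳 Q l ∘ₖ gibbsStep h𝒳 Q i

/-- The distribution after `k` Gibbs steps started from `p`. The features updated in these `k` steps
are drawn at random with law `order` (for instance a fresh uniformly random ordering of all features
in every round, a deterministic cycle, or independent uniform choices). -/
def gibbsLaw (h𝒳 : MeasurableSet 𝒳) (Q : Conditionals 𝒳) {k : ℕ} (order : PMF (Fin k → Fin d))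
    (p : Measure 𝒳) : Measure 𝒳 :=
  ∑ s : Fin k → Fin d, order s • (gibbsPath h𝒳 Q (List.ofFn s) ∘ₘ p)

/-- `X` is a sample of size `n` from `p`, and `X'` consists of `n` samples obtained after `k` Gibbs
steps started from `p`, one chain for each `i`: the chains for different `i` are independent of each
other. Nothing is required of the dependence between `X i` and `X' i`: this covers the chain that is
started at the point `X i` as well as an `X' i` that is independent of `X i`. -/
structure IsAugmentedSample {Ω : Type*} [MeasurableSpace Ω] (μ : Measure Ω)
    (h𝒳 : MeasurableSet 𝒳) (Q : Conditionals 𝒳) {k : ℕ} (order : PMF (Fin k → Fin d))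
    (p : Measure 𝒳) {n : ℕ} (X X' : Fin n → Ω → 𝒳) : Prop where
  law_fst : ∀ i, HasLaw (X i) p μ
  law_snd : ∀ i, HasLaw (X' i) (gibbsLaw h𝒳 Q order p) μ
  indep : iIndepFun (fun i ω => (X i ω, X' i ω)) μ

end Distill

end

/-! The n pairs (x_i, x_i') are independent, whatever the dependence inside a pair, and the
empirical distance is the average over i of the mean loss on the i-th pair. Its expectation for a
fixed student is (D(p) + D(q)) / 2, where q is the law after the Gibbs steps. Since the loss lies in
[0, 1], D(p) exceeds D(q) by at most Δ_k, so everything reduces to a VC generalization bound for n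
independent observations, not necessarily identically distributed.

The Rademacher average has order √(nV), without a logarithm: random sampling and Sauer–Shelah bound
packing numbers (`log_card_le_of_separated`), chaining over dyadic scales with Massart's lemma
treats set families (`sum_signed_indicator_le`), and integration over levels passes to functions
(`sum_signed_le_of_vcDim_le`).

A supremum over an uncountable class need not be measurable, so maxima appear as arbitrary
selections on finite index sets. To obtain such a set, the sample is viewed as a random choice of
one entry per row of an independent array with n rows. For a fixed array only finitely many students
occur, one for each choice, and symmetrization and McDiarmid's inequality are statements about
finite sums (`sum_exp_deviation_le`). By Jensen's inequality the row averages may then be replaced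
by true means, at the cost of a factor 1 - 1/m for m columns (`integral_exp_meanGap_le`). Four
columns and the Chernoff bound give the tail estimate `measureReal_meanGap_gt_le`. -/

noncomputable section

namespace Distill

/-! ### Rademacher averages of finite families -/

/-- The sign `1` or `-1` encoded by a Boolean. -/
def boolSign (b : Bool) : ℝ := bif b then 1 else -1

@[simp] lemma boolSign_not (b : Bool) : boolSign (!b) = -boolSign b := by
  cases b <;> simp [boolSign]

section Signs

variable {ι : Type*} [Fintype ι] [DecidableEq ι]

lemma sum_flip_signs (F : (ι → Bool) → ℝ) : ∑ s : ι → Bool, F (fun i => !s i) = ∑ s, F s :=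
  Fintype.sum_bijective (fun (s : ι → Bool) (i : ι) => !s i)
    (Function.Involutive.bijective fun s : ι → Bool => by funext i; simp) _ _ fun _ => rfl

lemma sum_boolSign_apply (i : ι) : ∑ s : ι → Bool, boolSign (s i) = 0 := by
  have h := sum_flip_signs (fun s : ι → Bool => boolSign (s i))
  simp only [boolSign_not, Finset.sum_neg_distrib] at h
  linarith

lemma sum_exp_signed_sum_le (t : ℝ) (a : ι → ℝ) :
    ∑ s : ι → Bool, Real.exp (t * ∑ i, boolSign (s i) * a i)
      ≤ 2 ^ Fintype.card ι * Real.exp (t ^ 2 * (∑ i, a i ^ 2) / 2) := by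
  have h1 : ∀ s : ι → Bool, Real.exp (t * ∑ i, boolSign (s i) * a i)
      = ∏ i, Real.exp (t * (boolSign (s i) * a i)) := fun s => by
    rw [← Real.exp_sum, Finset.mul_sum]
  have h2 : ∑ s : ι → Bool, ∏ i, Real.exp (t * (boolSign (s i) * a i))
      = ∏ i, ∑ b, Real.exp (t * (boolSign b * a i)) :=
    (Fintype.prod_sum fun i b => Real.exp (t * (boolSign b * a i))).symm
  simp only [h1]
  rw [h2]
  have h3 : ∀ i, ∑ b, Real.exp (t * (boolSign b * a i)) ≤ 2 * Real.exp (t ^ 2 * a i ^ 2 / 2) := by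
    intro i
    have := Real.cosh_le_exp_half_sq (t * a i)
    rw [Real.cosh_eq] at this
    simp only [Fintype.sum_bool, boolSign, cond_true, cond_false]
    rw [show t * (1 * a i) = t * a i by ring, show t * (-1 * a i) = -(t * a i) by ring,
      ← mul_pow]
    linarith
  calc _ ≤ ∏ i, 2 * Real.exp (t ^ 2 * a i ^ 2 / 2) :=
        Finset.prod_le_prod (fun i _ => Finset.sum_nonneg fun b _ => (Real.exp_pos _).le)
          fun i _ => h3 i
    _ = _ := by
        rw [Finset.prod_mul_distrib, ← Real.exp_sum, Finset.prod_const, Finset.card_univ,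
          Finset.mul_sum, Finset.sum_div]

/-- Massart's finite class lemma; the maximum is expressed through an arbitrary selection `w`. -/
lemma sum_signed_selection_le {κ : Type*} (T : Finset κ) (v : κ → ι → ℝ) {R L : ℝ} (hR : 0 < R)
    (hL : 0 < L) (hv : ∀ k ∈ T, ∑ i, v k i ^ 2 ≤ R) (hT : Real.log T.card ≤ L)
    (w : (ι → Bool) → κ) (hw : ∀ s, w s ∈ T) :
    ∑ s, ∑ i, boolSign (s i) * v (w s) i ≤ 2 ^ Fintype.card ι * √(2 * R * L) := by
  set y := √(2 * R * L) with hy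
  have hy0 : 0 < y := Real.sqrt_pos.2 (by positivity)
  have hy2 : y ^ 2 = 2 * R * L := Real.sq_sqrt (by positivity)
  -- This `t` minimizes L / t + t R / 2; both terms then equal y / 2, whence θ = t * y below.
  set t := y / R with ht
  have ht0 : 0 < t := by positivity
  have hTpos : (0 : ℝ) < T.card := by
    exact_mod_cast Finset.card_pos.2 ⟨_, hw fun _ => true⟩
  set θ := L + t ^ 2 * R / 2 with hθ
  have hcard : (T.card : ℝ) ≤ Real.exp L := (Real.log_le_iff_le_exp hTpos).1 hT
  -- The tangent line inequality u ≤ θ - 1 + exp (u - θ) replaces Jensen's inequality for the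
  -- logarithm.
  have h1 : ∀ s : ι → Bool, t * ∑ i, boolSign (s i) * v (w s) i
      ≤ θ - 1 + Real.exp (-θ) * ∑ k ∈ T, Real.exp (t * ∑ i, boolSign (s i) * v k i) := by
    intro s
    have h2 := Real.add_one_le_exp (t * ∑ i, boolSign (s i) * v (w s) i - θ)
    have h3 : Real.exp (t * ∑ i, boolSign (s i) * v (w s) i)
        ≤ ∑ k ∈ T, Real.exp (t * ∑ i, boolSign (s i) * v k i) :=
      Finset.single_le_sum (f := fun k => Real.exp (t * ∑ i, boolSign (s i) * v k i))
        (fun k _ => (Real.exp_pos _).le) (hw s)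
    rw [sub_eq_add_neg, Real.exp_add] at h2
    nlinarith [Real.exp_pos (-θ), mul_le_mul_of_nonneg_left h3 (Real.exp_pos (-θ)).le]
  have h2 : t * ∑ s, ∑ i, boolSign (s i) * v (w s) i ≤ 2 ^ Fintype.card ι * θ := by
    have hc : (Finset.univ : Finset (ι → Bool)).card = 2 ^ Fintype.card ι := by
      simp [Finset.card_univ]
    calc t * ∑ s, ∑ i, boolSign (s i) * v (w s) i
        ≤ ∑ s : ι → Bool, (θ - 1 + Real.exp (-θ)
            * ∑ k ∈ T, Real.exp (t * ∑ i, boolSign (s i) * v k i)) := by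
          rw [Finset.mul_sum]; exact Finset.sum_le_sum fun s _ => h1 s
      _ = 2 ^ Fintype.card ι * (θ - 1) + Real.exp (-θ)
            * ∑ k ∈ T, ∑ s : ι → Bool, Real.exp (t * ∑ i, boolSign (s i) * v k i) := by
          rw [Finset.sum_add_distrib, Finset.sum_const, hc, ← Finset.mul_sum,
            Finset.sum_comm (s := Finset.univ)]
          simp
      _ ≤ 2 ^ Fintype.card ι * (θ - 1) + Real.exp (-θ)
            * ∑ k ∈ T, 2 ^ Fintype.card ι * Real.exp (t ^ 2 * R / 2) := by
          gcongr with k hk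
          refine (sum_exp_signed_sum_le t (v k)).trans ?_
          gcongr
          exact hv k hk
      _ = 2 ^ Fintype.card ι * (θ - 1) + 2 ^ Fintype.card ι * (T.card *
            (Real.exp (-θ) * Real.exp (t ^ 2 * R / 2))) := by
          rw [Finset.sum_const, nsmul_eq_mul]; ring
      _ ≤ 2 ^ Fintype.card ι * (θ - 1) + 2 ^ Fintype.card ι * 1 := by
          gcongr
          rw [← Real.exp_add, show -θ + t ^ 2 * R / 2 = -L by rw [hθ]; ring, Real.exp_neg]
          exact mul_inv_le_one_of_le₀ hcard (Real.exp_pos _).le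
      _ = _ := by ring
  have h3 : θ = t * y := by
    rw [hθ, ht, div_mul_eq_mul_div, ← pow_two, hy2]
    field_simp
    rw [hy2]; ring
  rw [h3] at h2
  refine le_of_mul_le_mul_left ?_ ht0
  linarith

end Signs

/-! ### Packing numbers of set families of bounded VC dimension -/

section Packing

variable {ι : Type*} [DecidableEq ι]

/-- A weighted form of the Sauer–Shelah bound, for the trace of a family on `S`. -/
lemma card_mul_pow_le_of_injOn_inter (𝒜 : Finset (Finset ι)) {V : ℕ}
    (hV : ∀ S, 𝒜.Shatters S → S.card ≤ V) (S : Finset ι)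
    (hS : Set.InjOn (fun A => A ∩ S) (𝒜 : Set (Finset ι))) {x : ℝ} (hx : 0 ≤ x) (hx1 : x ≤ 1) :
    𝒜.card * x ^ V ≤ (1 + x) ^ S.card := by
  set ℬ := 𝒜.image (fun A => A ∩ S) with hℬ
  have hcard : 𝒜.card = ℬ.card := (Finset.card_image_of_injOn hS).symm
  -- A set shattered by the trace lies in `S` and is shattered by `𝒜`. By Pajor's inequality,
  -- counting such sets bounds the family; the weights x ^ |T| ≥ x ^ V then sum to a binomial
  -- expansion.
  have hsub : ∀ T ∈ ℬ.shatterer, T ⊆ S ∧ T.card ≤ V := by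
    intro T hT
    rw [Finset.mem_shatterer] at hT
    have hTS : T ⊆ S := by
      obtain ⟨B, hB, hTB⟩ := hT (Finset.Subset.refl T)
      obtain ⟨A, -, rfl⟩ := Finset.mem_image.1 hB
      intro i hi
      rw [← hTB] at hi
      simp only [Finset.mem_inter] at hi
      exact hi.2.2
    refine ⟨hTS, hV T fun U hU => ?_⟩
    obtain ⟨B, hB, hTB⟩ := hT hU
    obtain ⟨A, hA, rfl⟩ := Finset.mem_image.1 hB
    refine ⟨A, hA, ?_⟩
    rw [← hTB]
    ext i
    simp only [Finset.mem_inter]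
    exact ⟨fun h => ⟨h.1, h.2, hTS h.1⟩, fun h => ⟨h.1, h.2.1⟩⟩
  calc (𝒜.card : ℝ) * x ^ V ≤ ℬ.shatterer.card * x ^ V := by
        rw [hcard]
        exact mul_le_mul_of_nonneg_right (by exact_mod_cast ℬ.card_le_card_shatterer)
          (by positivity)
    _ = ∑ T ∈ ℬ.shatterer, x ^ V := by rw [Finset.sum_const, nsmul_eq_mul]
    _ ≤ ∑ T ∈ ℬ.shatterer, x ^ T.card :=
        Finset.sum_le_sum fun T hT => pow_le_pow_of_le_one hx hx1 (hsub T hT).2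
    _ ≤ ∑ T ∈ S.powerset, x ^ T.card :=
        Finset.sum_le_sum_of_subset_of_nonneg
          (fun T hT => Finset.mem_powerset.2 (hsub T hT).1) fun _ _ _ => by positivity
    _ = (1 + x) ^ S.card := by
        have := Finset.prod_one_add (f := fun _ : ι => x) S
        simpa using this.symm

variable [Fintype ι] [Nonempty ι]

/-- Random sampling separates all members of a well separated family. -/
lemma exists_sample_separating (𝒜 : Finset (Finset ι)) (h𝒜 : 𝒜.Nonempty) {ε : ℝ}
    (hsep : ∀ A ∈ 𝒜, ∀ B ∈ 𝒜, A ≠ B → ε * Fintype.card ι ≤ (symmDiff A B).card)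
    {k : ℕ} (hk : 2 * Real.log 𝒜.card ≤ ε * k) :
    ∃ t : Fin k → ι, ∀ A ∈ 𝒜, ∀ B ∈ 𝒜, A ≠ B → ∃ l, t l ∈ symmDiff A B := by
  by_contra! hcon
  set n : ℝ := (Fintype.card ι : ℝ) with hn
  have hn0 : 0 < n := by rw [hn]; exact_mod_cast Fintype.card_pos
  have hm0 : (0 : ℝ) < 𝒜.card := by exact_mod_cast h𝒜.card_pos
  -- Union bound by counting: if every sample failed, the samples missing some symmetric difference
  -- would cover all of them.
  have hcover : (Finset.univ : Finset (Fin k → ι)) ⊆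
      𝒜.offDiag.biUnion fun q => Fintype.piFinset fun _ : Fin k => (symmDiff q.1 q.2)ᶜ := by
    intro t _
    obtain ⟨A, hA, B, hB, hAB, h⟩ := hcon t
    rw [Finset.mem_biUnion]
    exact ⟨(A, B), Finset.mem_offDiag.2 ⟨hA, hB, hAB⟩,
      Fintype.mem_piFinset.2 fun l => Finset.mem_compl.2 (h l)⟩
  have h1 : n ^ k ≤ ∑ q ∈ 𝒜.offDiag, ((symmDiff q.1 q.2)ᶜ.card : ℝ) ^ k := by
    have := (Finset.card_le_card hcover).trans Finset.card_biUnion_le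
    simp only [Finset.card_univ, Fintype.card_fun, Fintype.card_fin, Fintype.card_piFinset_const]
      at this
    rw [hn]
    exact_mod_cast this
  have h2 : ∀ q ∈ 𝒜.offDiag, ((symmDiff q.1 q.2)ᶜ.card : ℝ) ^ k ≤ n ^ k * Real.exp (-(ε * k)) := by
    intro q hq
    rw [Finset.mem_offDiag] at hq
    have h3 := hsep _ hq.1 _ hq.2.1 hq.2.2
    have h4 : ((symmDiff q.1 q.2)ᶜ.card : ℝ) = n - (symmDiff q.1 q.2).card := by
      rw [Finset.card_compl, Nat.cast_sub (Finset.card_le_univ _)]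
    have h5 : ((symmDiff q.1 q.2)ᶜ.card : ℝ) ≤ n * Real.exp (-ε) := by
      rw [h4]
      nlinarith [Real.add_one_le_exp (-ε)]
    calc ((symmDiff q.1 q.2)ᶜ.card : ℝ) ^ k ≤ (n * Real.exp (-ε)) ^ k := by gcongr
      _ = _ := by rw [mul_pow, ← Real.exp_nat_mul]; ring_nf
  have h3 : n ^ k ≤ 𝒜.offDiag.card * (n ^ k * Real.exp (-(ε * k))) := by
    refine h1.trans ((Finset.sum_le_sum h2).trans_eq ?_)
    rw [Finset.sum_const, nsmul_eq_mul]
  -- Strictness comes from omitting the diagonal; it yields the contradiction, as `h5` is not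
  -- strict.
  have h4 : (𝒜.offDiag.card : ℝ) < (𝒜.card : ℝ) ^ 2 := by
    rw [Finset.offDiag_card, Nat.cast_sub (Nat.le_mul_self _)]
    push_cast
    nlinarith
  have h5 : (𝒜.card : ℝ) ^ 2 * Real.exp (-(ε * k)) ≤ 1 := by
    have : (𝒜.card : ℝ) ^ 2 = Real.exp (2 * Real.log 𝒜.card) := by
      rw [mul_comm, Real.exp_mul, Real.exp_log hm0]; norm_num
    rw [this, ← Real.exp_add, Real.exp_le_one_iff]
    linarith
  have hp : 0 < n ^ k := by positivity
  have he := Real.exp_pos (-(ε * k))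
  have h6 : (𝒜.offDiag.card : ℝ) * Real.exp (-(ε * k)) < 1 :=
    (mul_lt_mul_of_pos_right h4 he).trans_le h5
  nlinarith

/-- The packing bound for set families of VC dimension at most `V`. -/
lemma log_card_le_of_separated (𝒜 : Finset (Finset ι)) (h𝒜 : 𝒜.Nonempty) {V : ℕ}
    (hV : ∀ S, 𝒜.Shatters S → S.card ≤ V) {ε : ℝ} (hε : 0 < ε) (hε1 : ε ≤ 1)
    (hsep : ∀ A ∈ 𝒜, ∀ B ∈ 𝒜, A ≠ B → ε * Fintype.card ι ≤ (symmDiff A B).card) :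
    Real.log 𝒜.card ≤ 2 * V * Real.log (4 / ε) + 1 / 2 := by
  set l := Real.log 𝒜.card with hl
  have hm1 : (1 : ℝ) ≤ 𝒜.card := by exact_mod_cast h𝒜.card_pos
  have hl0 : 0 ≤ l := Real.log_nonneg hm1
  set k := ⌈2 * l / ε⌉₊ with hk
  have hk1 : 2 * l ≤ ε * k := by
    rw [mul_comm ε]; exact (div_le_iff₀ hε).1 (Nat.le_ceil _)
  have hk2 : ε * k ≤ 2 * l + ε := by
    have := (Nat.ceil_lt_add_one (a := 2 * l / ε) (by positivity)).le
    calc ε * k ≤ ε * (2 * l / ε + 1) := by gcongr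
      _ = _ := by field_simp
  obtain ⟨t, ht⟩ := exists_sample_separating 𝒜 h𝒜 hsep hk1
  set S := Finset.univ.image t
  have hSk : S.card ≤ k := Finset.card_image_le.trans (by simp)
  have hinj : Set.InjOn (fun A => A ∩ S) (𝒜 : Set (Finset ι)) := by
    intro A hA B hB hAB
    by_contra hne
    obtain ⟨i, hi⟩ := ht A hA B hB hne
    have hiS : t i ∈ S := Finset.mem_image_of_mem t (Finset.mem_univ i)
    have : t i ∈ A ∩ S ↔ t i ∈ B ∩ S := by
      simp only at hAB; rw [hAB]
    simp only [Finset.mem_inter, hiS, and_true] at this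
    rw [Finset.mem_symmDiff] at hi
    tauto
  -- The sample size is about 2l / ε, so x = ε / 4 leaves l / 2 + ε / 4 on the right, and the half
  -- of l is absorbed on the left.
  have h := card_mul_pow_le_of_injOn_inter 𝒜 hV S hinj (x := ε / 4) (by positivity) (by linarith)
  have h2 : (1 + ε / 4) ^ S.card ≤ Real.exp (ε / 4 * k) :=
    calc (1 + ε / 4) ^ S.card ≤ (1 + ε / 4) ^ k :=
          pow_le_pow_right₀ (by linarith) hSk
      _ ≤ Real.exp (ε / 4) ^ k := by
          gcongr; rw [add_comm]; exact Real.add_one_le_exp _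
      _ = _ := by rw [← Real.exp_nat_mul, mul_comm]
  have h3 := Real.log_le_log (by positivity) (h.trans h2)
  rw [Real.log_exp, Real.log_mul (by positivity) (by positivity), Real.log_pow,
    show ε / 4 = (4 / ε)⁻¹ by rw [inv_div], Real.log_inv, ← hl, inv_div] at h3
  nlinarith

end Packing

/-! ### Chaining -/

section Chaining

variable {ι : Type*} [Fintype ι] [DecidableEq ι]

/-- A maximal `r`-separated subfamily is an `r`-net. -/
lemma exists_separated_net (𝒜 : Finset (Finset ι)) (r : ℝ) :
    ∃ ℬ ⊆ 𝒜, (∀ A ∈ ℬ, ∀ B ∈ ℬ, A ≠ B → r < (symmDiff A B).card) ∧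
      ∀ A ∈ 𝒜, ∃ B ∈ ℬ, A = B ∨ ((symmDiff A B).card : ℝ) ≤ r := by
  classical
  set P := 𝒜.powerset.filter fun ℬ => ∀ A ∈ ℬ, ∀ B ∈ ℬ, A ≠ B → r < (symmDiff A B).card
  have hP : P.Nonempty := ⟨∅, by simp [P]⟩
  obtain ⟨ℬ, hℬ, hmax⟩ := P.exists_max_image Finset.card hP
  simp only [P, Finset.mem_filter, Finset.mem_powerset] at hℬ hmax
  refine ⟨ℬ, hℬ.1, hℬ.2, fun A hA => ?_⟩
  by_contra! hcon
  have hA' : A ∉ ℬ := fun h => (hcon A h).1 rfl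
  have := hmax (insert A ℬ) ⟨Finset.insert_subset hA hℬ.1, by
    intro B hB C hC hBC
    rw [Finset.mem_insert] at hB hC
    rcases hB with rfl | hB <;> rcases hC with rfl | hC
    · exact absurd rfl hBC
    · exact (hcon C hC).2
    · rw [symmDiff_comm]; exact (hcon B hB).2
    · exact hℬ.2 B hB C hC hBC⟩
  rw [Finset.card_insert_of_notMem hA'] at this
  omega

/-- The cost of one chaining link decays geometrically; the right-hand side is a difference of
consecutive values of 40 * (1 - (9 / 10) ^ k), so the links telescope. -/
lemma chaining_link_le (k : ℕ) :
    √(4 * (k + 3) / 2 ^ k) ≤ 40 * (1 - 9 / 10) * (9 / 10 : ℝ) ^ k := by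
  apply Real.sqrt_le_iff.2 ⟨by positivity, ?_⟩
  have h : ∀ k : ℕ, ((k : ℝ) + 3) ≤ 4 * (81 / 50) ^ k := by
    intro k
    induction k with
    | zero => norm_num
    | succ k ih => push_cast; rw [pow_succ]; nlinarith
  rw [div_le_iff₀ (by positivity)]
  calc 4 * ((k : ℝ) + 3) ≤ 4 * (4 * (81 / 50) ^ k) := by gcongr; exact h k
    _ = 16 * ((9 / 10) * (9 / 10) * 2) ^ k := by norm_num; ring
    _ = _ := by rw [mul_pow, mul_pow]; ring

/-- Chaining as an induction on the scale: project the selection onto a net at the next coarser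
scale, and bound the differences by Massart's lemma, since they have small Euclidean norm and few
values. -/
lemma sum_signed_indicator_le_of_separated [Nonempty ι] {V : ℕ} (hV0 : 0 < V) (k : ℕ) :
    ∀ 𝒜 : Finset (Finset ι), (∀ S, 𝒜.Shatters S → S.card ≤ V) →
      (∀ A ∈ 𝒜, ∀ B ∈ 𝒜, A ≠ B → Fintype.card ι / (2 : ℝ) ^ k < (symmDiff A B).card) →
      ∀ w : (ι → Bool) → Finset ι, (∀ s, w s ∈ 𝒜) →
        ∑ s, ∑ i, boolSign (s i) * (if i ∈ w s then 1 else 0)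
          ≤ 2 ^ Fintype.card ι * (√(Fintype.card ι * V) * (40 * (1 - (9 / 10) ^ k))) := by
  have hn0 : (0 : ℝ) < Fintype.card ι := by exact_mod_cast Fintype.card_pos
  have hV1 : (1 : ℝ) ≤ V := by exact_mod_cast hV0
  induction k with
  | zero =>
    intro 𝒜 hV hsep w hw
    -- No two sets differ in more than n points, so the family is a singleton and the signs average
    -- to zero.
    have hconst : ∀ s, w s = w fun _ => true := by
      intro s
      by_contra hne
      have := hsep _ (hw s) _ (hw _) hne
      rw [pow_zero, div_one] at this
      exact absurd (Finset.card_le_univ (symmDiff (w s) (w fun _ => true)))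
        (not_le.2 (by exact_mod_cast this))
    rw [Finset.sum_comm]
    have : ∀ i : ι, ∑ s : ι → Bool, boolSign (s i) * (if i ∈ w s then (1 : ℝ) else 0) = 0 := by
      intro i
      have h0 : ∀ s, (if i ∈ w s then (1 : ℝ) else 0) = if i ∈ w (fun _ => true) then 1 else 0 :=
        fun s => by rw [hconst s]
      simp only [h0]
      rw [← Finset.sum_mul, sum_boolSign_apply, zero_mul]
    rw [Finset.sum_congr rfl fun i _ => this i]
    simp
  | succ k ih =>
    intro 𝒜 hV hsep w hw
    obtain ⟨ℬ, hℬ𝒜, hℬ, hnet⟩ := exists_separated_net 𝒜 (Fintype.card ι / (2 : ℝ) ^ k)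
    choose! π hπ hπd using hnet
    have hB := ih ℬ (fun S hS => hV S (hS.mono_left hℬ𝒜)) hℬ (fun s => π (w s))
      fun s => hπ _ (hw s)
    have hR : 0 < Fintype.card ι / (2 : ℝ) ^ k := by positivity
    have hlog : Real.log 𝒜.card ≤ 2 * V * (k + 3) := by
      have h := log_card_le_of_separated 𝒜 ⟨_, hw fun _ => true⟩ hV
        (ε := 1 / 2 ^ (k + 1)) (by positivity)
        (by rw [div_le_one (by positivity)]; exact one_le_pow₀ (by norm_num))
        fun A hA B hB hAB => by
          have := (hsep A hA B hB hAB).le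
          rwa [div_eq_mul_one_div, mul_comm] at this
      have h4 : (4 : ℝ) / (1 / 2 ^ (k + 1)) = 2 ^ (k + 3) := by
        rw [div_div_eq_mul_div]; ring
      rw [h4, Real.log_pow] at h
      push_cast at h
      have hl2 := Real.log_two_lt_d9
      have hk0 : (0 : ℝ) ≤ k := k.cast_nonneg
      have h5 : 2 * (V : ℝ) * ((k + 3) * Real.log 2) ≤ 2 * V * ((k + 3) * 0.7) := by
        gcongr; linarith
      nlinarith
    have hlink := sum_signed_selection_le 𝒜
      (fun A i => (if i ∈ A then (1 : ℝ) else 0) - if i ∈ π A then 1 else 0)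
      hR (L := 2 * V * (k + 3)) (by positivity) (by
        intro A hA
        have h1 : ∀ i, ((if i ∈ A then (1 : ℝ) else 0) - if i ∈ π A then 1 else 0) ^ 2
            = if i ∈ symmDiff A (π A) then 1 else 0 := by
          intro i
          by_cases h1 : i ∈ A <;> by_cases h2 : i ∈ π A <;> simp [Finset.mem_symmDiff, h1, h2]
        simp only [h1]
        rw [Finset.sum_boole, Finset.filter_mem_eq_inter, Finset.univ_inter]
        rcases hπd A hA with h | h
        · rw [← h]; simp only [symmDiff_self, Finset.bot_eq_empty, Finset.card_empty,
            Nat.cast_zero]; positivity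
        · exact h) hlog w hw
    have hs : √(2 * (Fintype.card ι / (2 : ℝ) ^ k) * (2 * V * (k + 3)))
        = √(Fintype.card ι * V) * √(4 * (k + 3) / 2 ^ k) := by
      rw [← Real.sqrt_mul (by positivity)]; congr 1; ring
    rw [hs] at hlink
    calc ∑ s, ∑ i, boolSign (s i) * (if i ∈ w s then 1 else 0)
        = ∑ s, ∑ i, boolSign (s i) * (if i ∈ π (w s) then 1 else 0)
          + ∑ s, ∑ i, boolSign (s i)
            * ((if i ∈ w s then (1 : ℝ) else 0) - if i ∈ π (w s) then 1 else 0) := by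
          rw [← Finset.sum_add_distrib]
          refine Finset.sum_congr rfl fun s _ => ?_
          rw [← Finset.sum_add_distrib]
          exact Finset.sum_congr rfl fun i _ => by ring
      _ ≤ _ := add_le_add hB hlink
      _ ≤ 2 ^ Fintype.card ι * (√(Fintype.card ι * V) * (40 * (1 - (9 / 10) ^ k)))
          + 2 ^ Fintype.card ι
            * (√(Fintype.card ι * V) * (40 * (1 - 9 / 10) * (9 / 10 : ℝ) ^ k)) := by
          gcongr; exact chaining_link_le k
      _ = _ := by rw [pow_succ]; ring

/-- The Rademacher average of a set family of VC dimension at most `V` has order `√(n V)`. -/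
theorem sum_signed_indicator_le [Nonempty ι] {V : ℕ} (hV0 : 0 < V) (𝒜 : Finset (Finset ι))
    (hV : ∀ S, 𝒜.Shatters S → S.card ≤ V) (w : (ι → Bool) → Finset ι) (hw : ∀ s, w s ∈ 𝒜) :
    ∑ s, ∑ i, boolSign (s i) * (if i ∈ w s then 1 else 0)
      ≤ 2 ^ Fintype.card ι * (40 * √(Fintype.card ι * V)) := by
  -- At scale n / 2 ^ k < 1, distinct sets are separated automatically.
  obtain ⟨k, hk⟩ := pow_unbounded_of_one_lt (Fintype.card ι : ℝ) (one_lt_two)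
  refine (sum_signed_indicator_le_of_separated hV0 k 𝒜 hV (fun A _ B _ hAB => ?_) w hw).trans ?_
  · have h1 : (1 : ℝ) ≤ (symmDiff A B).card := by
      have : (symmDiff A B).Nonempty := by
        rw [Finset.nonempty_iff_ne_empty]
        intro h
        exact hAB (symmDiff_eq_bot.1 h)
      exact_mod_cast this.card_pos
    exact ((div_lt_one (by positivity)).2 hk).trans_le h1
  · have h1 : (0 : ℝ) ≤ (9 / 10) ^ k := by positivity
    have h2 := Real.sqrt_nonneg ((Fintype.card ι : ℝ) * V)
    have : √(Fintype.card ι * V) * (40 * (1 - (9 / 10) ^ k)) ≤ 40 * √(Fintype.card ι * V) := by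
      nlinarith [mul_nonneg h1 h2]
    gcongr

end Chaining

/-! ### From sets to functions -/

lemma integrableOn_levelIndicator (y : ℝ) :
    IntegrableOn (fun r : ℝ => if r < y then (1 : ℝ) else 0) (Set.Ioc 0 1) :=
  Integrable.of_mem_Icc 0 1
    (Measurable.ite measurableSet_Iio measurable_const measurable_const).aemeasurable
    (Filter.Eventually.of_forall fun r => by split_ifs <;> simp)

lemma integral_levelIndicator {y : ℝ} (hy0 : 0 ≤ y) (hy1 : y ≤ 1) :
    ∫ r in Set.Ioc (0 : ℝ) 1, (if r < y then (1 : ℝ) else 0) = y := by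
  have h : (fun r : ℝ => if r < y then (1 : ℝ) else 0) = (Set.Iio y).indicator 1 := by
    ext r; simp [Set.indicator_apply]
  rw [h, integral_indicator_one measurableSet_Iio, measureReal_restrict_apply measurableSet_Iio]
  have h2 : Set.Iio y ∩ Set.Ioc 0 1 = Set.Ioo 0 y := by
    ext r
    simp only [Set.mem_inter_iff, Set.mem_Iio, Set.mem_Ioc, Set.mem_Ioo]
    exact ⟨fun h => ⟨h.2.1, h.1⟩, fun h => ⟨h.2, h.1, h.2.le.trans hy1⟩⟩
  rw [h2]
  simp [hy0]

lemma le_of_shattersSome {𝒳 : Type*} {F : Set (𝒳 → ℝ)} {V m : ℕ} (hF : vcDim F ≤ V)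
    (h : ShattersSome F m) : m ≤ V := by
  have : (m : ℕ∞) ≤ vcDim F := le_iSup₂ (f := fun (m : ℕ) (_ : ShattersSome F m) => (m : ℕ∞)) m h
  exact_mod_cast this.trans hF

/-- The Rademacher average of a class of `[0, 1]`-valued functions of VC dimension at most `V`. -/
theorem sum_signed_le_of_vcDim_le {𝒳 ι : Type*} [Fintype ι] [Nonempty ι] [DecidableEq ι]
    {F : Set (𝒳 → ℝ)} {V : ℕ} (hV : 0 < V) (hF : vcDim F ≤ V)
    (hF01 : ∀ h ∈ F, ∀ x, 0 ≤ h x ∧ h x ≤ 1) (x : ι → 𝒳) (w : (ι → Bool) → 𝒳 → ℝ)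
    (hw : ∀ s, w s ∈ F) :
    ∑ s, ∑ i, boolSign (s i) * w s (x i)
      ≤ 2 ^ Fintype.card ι * (40 * √(Fintype.card ι * V)) := by
  classical
  have hlevel : ∀ r : ℝ, ∑ s, ∑ i, boolSign (s i) * (if r < w s (x i) then 1 else 0)
      ≤ 2 ^ Fintype.card ι * (40 * √(Fintype.card ι * V)) := by
    intro r
    set A : (ι → Bool) → Finset ι := fun s => Finset.univ.filter fun i => r < w s (x i) with hA
    have := sum_signed_indicator_le hV (Finset.univ.image A) (fun S hS => ?_) A
      fun s => Finset.mem_image_of_mem A (Finset.mem_univ s)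
    · simpa [hA] using this
    -- Superlevel sets at one common height are sections of the subgraphs, so the constant level `r`
    -- witnesses the shattering.
    · refine le_of_shattersSome hF ⟨fun l => x (S.equivFin.symm l), fun _ => r, fun s => ?_⟩
      obtain ⟨B, hB, hSB⟩ := hS (t := S.filter fun i => ∃ l ∈ s, (S.equivFin.symm l : ι) = i)
        (Finset.filter_subset _ _)
      obtain ⟨u, -, rfl⟩ := Finset.mem_image.1 hB
      refine ⟨w u, hw u, fun l => ?_⟩
      have h1 : (S.equivFin.symm l : ι) ∈ S ∩ A u ↔ l ∈ s := by
        rw [hSB, Finset.mem_filter]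
        constructor
        · rintro ⟨-, l', hl', h⟩
          rwa [S.equivFin.symm.injective (Subtype.ext h)] at hl'
        · exact fun h => ⟨Subtype.prop _, l, h, rfl⟩
      rw [← h1, Finset.mem_inter]
      simp [hA]
  have hint : ∀ s i, IntegrableOn
      (fun r : ℝ => boolSign (s i) * (if r < w s (x i) then (1 : ℝ) else 0)) (Set.Ioc 0 1) :=
    fun s i => (integrableOn_levelIndicator _).const_mul _
  calc ∑ s, ∑ i, boolSign (s i) * w s (x i)
      = ∑ s, ∑ i, ∫ r in Set.Ioc (0 : ℝ) 1,
          boolSign (s i) * (if r < w s (x i) then (1 : ℝ) else 0) := by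
        refine Finset.sum_congr rfl fun s _ => Finset.sum_congr rfl fun i _ => ?_
        rw [integral_const_mul, integral_levelIndicator (hF01 _ (hw s) _).1 (hF01 _ (hw s) _).2]
    _ = ∫ r in Set.Ioc (0 : ℝ) 1,
          ∑ s, ∑ i, boolSign (s i) * (if r < w s (x i) then (1 : ℝ) else 0) := by
        rw [integral_finsetSum _ fun s _ => integrable_finsetSum _ fun i _ => hint s i]
        exact Finset.sum_congr rfl fun s _ => (integral_finsetSum _ fun i _ => hint s i).symm
    _ ≤ ∫ r in Set.Ioc (0 : ℝ) 1, 2 ^ Fintype.card ι * (40 * √(Fintype.card ι * V)) :=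
        integral_mono
          (integrable_finsetSum _ fun s _ => integrable_finsetSum _ fun i _ => hint s i)
          (integrable_const _) hlevel
    _ = _ := by simp

/-! ### Bounded differences -/

/-- Hoeffding's lemma for the uniform distribution on a finite type. -/
lemma sum_exp_le_of_sub_le_one {α : Type*} [Fintype α] [Nonempty α] (f : α → ℝ)
    (hf : ∀ a b, f a - f b ≤ 1) (t : ℝ) :
    ∑ a, Real.exp (t * f a)
      ≤ Fintype.card α * Real.exp (t * ((∑ a, f a) / Fintype.card α) + t ^ 2 / 8) := by
  let _ : MeasurableSpace α := ⊤
  set P := (PMF.uniformOfFintype α).toMeasure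
  have hint : ∀ g : α → ℝ, ∫ a, g a ∂P = (∑ a, g a) / Fintype.card α := fun g => by
    rw [PMF.integral_eq_sum]
    simp [PMF.uniformOfFintype_apply, div_eq_inv_mul, Finset.mul_sum]
  obtain ⟨a₀, ha₀⟩ := Finite.exists_min f
  have h := (hasSubgaussianMGF_of_mem_Icc (μ := P) (X := f) (a := f a₀) (b := f a₀ + 1)
    (measurable_of_finite f).aemeasurable
    (Filter.Eventually.of_forall fun a => ⟨ha₀ a, by linarith [hf a a₀]⟩)).mgf_le t
  rw [mgf, hint, hint] at h
  have hc : (0 : ℝ) < Fintype.card α := by exact_mod_cast Fintype.card_pos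
  simp only [mul_sub, Real.exp_sub] at h
  rw [← Finset.sum_div, div_le_iff₀ hc, div_le_iff₀ (Real.exp_pos _)] at h
  refine h.trans_eq ?_
  rw [mul_right_comm, ← Real.exp_add, mul_comm]
  congr 2
  simp
  ring

/-- McDiarmid's inequality for the uniform distribution on a finite product. -/
lemma sum_exp_le_of_bounded_differences {α : Type*} [Fintype α] [Nonempty α] (t : ℝ) (n : ℕ) :
    ∀ F : (Fin n → α) → ℝ, (∀ i j a, F (Function.update j i a) - F j ≤ 1) →
      ∑ j, Real.exp (t * F j) ≤ Fintype.card α ^ n *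
        Real.exp (t * ((∑ j, F j) / Fintype.card α ^ n) + n * t ^ 2 / 8) := by
  have hc : (0 : ℝ) < Fintype.card α := by exact_mod_cast Fintype.card_pos
  induction n with
  | zero => intro F _; simp
  | succ n ih =>
    intro F hF
    have hsum : ∀ H : (Fin (n + 1) → α) → ℝ,
        ∑ j, H j = ∑ u : Fin n → α, ∑ a, H (Fin.cons a u) := fun H => by
      rw [← (Fin.consEquiv fun _ : Fin (n + 1) => α).sum_comp, Fintype.sum_prod_type_right]
      rfl
    -- Averaging out the first coordinate preserves bounded differences; Hoeffding's lemma pays t ^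
    -- 2 / 8 for that coordinate.
    set G : (Fin n → α) → ℝ := fun u => (∑ a, F (Fin.cons a u)) / Fintype.card α with hG
    have hGd : ∀ i u b, G (Function.update u i b) - G u ≤ 1 := by
      intro i u b
      rw [hG, ← sub_div, ← Finset.sum_sub_distrib, div_le_one hc]
      calc _ ≤ ∑ _a : α, (1 : ℝ) := Finset.sum_le_sum fun a _ => by
            rw [Fin.cons_update]; exact hF _ _ _
        _ = _ := by simp
    calc ∑ j, Real.exp (t * F j)
        = ∑ u : Fin n → α, ∑ a, Real.exp (t * F (Fin.cons a u)) := hsum _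
      _ ≤ ∑ u : Fin n → α, Fintype.card α * Real.exp (t * G u + t ^ 2 / 8) :=
          Finset.sum_le_sum fun u _ => sum_exp_le_of_sub_le_one (fun a => F (Fin.cons a u))
            (fun a b => by
              have := hF 0 (Fin.cons b u) a
              rwa [Fin.update_cons_zero] at this) t
      _ = Fintype.card α * Real.exp (t ^ 2 / 8) * ∑ u, Real.exp (t * G u) := by
          rw [Finset.mul_sum]
          exact Finset.sum_congr rfl fun u _ => by rw [Real.exp_add]; ring
      _ ≤ Fintype.card α * Real.exp (t ^ 2 / 8) * (Fintype.card α ^ n *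
            Real.exp (t * ((∑ u, G u) / Fintype.card α ^ n) + n * t ^ 2 / 8)) := by
          gcongr; exact ih G hGd
      _ = _ := by
          have h1 : (∑ u, G u) / (Fintype.card α : ℝ) ^ n
              = (∑ j, F j) / (Fintype.card α : ℝ) ^ (n + 1) := by
            rw [hsum F, hG, ← Finset.sum_div, div_div, pow_succ']
          rw [h1, show (Fintype.card α : ℝ) * Real.exp (t ^ 2 / 8) * (Fintype.card α ^ n *
              Real.exp (t * ((∑ j, F j) / Fintype.card α ^ (n + 1)) + n * t ^ 2 / 8))
            = Fintype.card α ^ (n + 1) * (Real.exp (t ^ 2 / 8) *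
              Real.exp (t * ((∑ j, F j) / Fintype.card α ^ (n + 1)) + n * t ^ 2 / 8)) by ring,
            ← Real.exp_add]
          push_cast
          ring_nf

/-! ### Symmetrization -/

section Symmetrization

variable {α : Type*} {n : ℕ}

/-- Exchange the `i`-th entries of two tuples wherever `s i` is false. -/
def swapPair (s : Fin n → Bool) (q : (Fin n → α) × (Fin n → α)) :
    (Fin n → α) × (Fin n → α) :=
  (fun i => bif s i then q.1 i else q.2 i, fun i => bif s i then q.2 i else q.1 i)

lemma swapPair_involutive (s : Fin n → Bool) : Function.Involutive (swapPair (α := α) s) := by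
  rintro ⟨j, j'⟩
  simp only [swapPair, Prod.mk.injEq]
  constructor <;> funext i <;> cases s i <;> rfl

variable [Fintype α]

lemma sum_apply_eq_card_pow_mul_mean [Nonempty α] (i : Fin n) (f : α → ℝ) :
    ∑ j : Fin n → α, f (j i) = Fintype.card α ^ n * ((∑ a, f a) / Fintype.card α) := by
  have hc : (Fintype.card α : ℝ) ≠ 0 := by exact_mod_cast Fintype.card_ne_zero
  have h1 : ∑ j : Fin n → α, f (j i)
      = Fintype.card ({l // l ≠ i} → α) * ∑ a, f a := by
    rw [← (Equiv.funSplitAt i α).symm.sum_comp, Fintype.sum_prod_type_right]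
    simp [Equiv.funSplitAt, Equiv.piSplitAt]
  have h2 : (Fintype.card α : ℝ) ^ n = Fintype.card α * Fintype.card ({l // l ≠ i} → α) := by
    have := Fintype.card_congr (Equiv.funSplitAt i α)
    rw [Fintype.card_prod, Fintype.card_fun, Fintype.card_fin] at this
    exact_mod_cast this
  rw [h1, h2]
  field_simp

variable {κ : Type*} (a : κ → Fin n → α → ℝ) {B : ℝ}

/-- The symmetrized deviations are controlled by the Rademacher averages of the arrays. -/
lemma sum_selected_difference_le
    (hrad : ∀ (j : Fin n → α) (w : (Fin n → Bool) → κ),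
      ∑ s, ∑ i, boolSign (s i) * a (w s) i (j i) ≤ 2 ^ n * B)
    (K : (Fin n → α) × (Fin n → α) → κ) :
    ∑ q, ∑ i, (a (K q) i (q.2 i) - a (K q) i (q.1 i))
      ≤ (Fintype.card α : ℝ) ^ n * Fintype.card α ^ n * (2 * B) := by
  set Q : (Fin n → α) × (Fin n → α) → ℝ :=
    fun q => ∑ i, (a (K q) i (q.2 i) - a (K q) i (q.1 i)) with hQ
  have hswap : ∀ s q, Q (swapPair s q)
      = ∑ i, boolSign (s i) * a (K (swapPair s q)) i (q.2 i)
        + ∑ i, boolSign (!s i) * a (K (swapPair s q)) i (q.1 i) := by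
    intro s q
    rw [hQ, ← Finset.sum_add_distrib]
    refine Finset.sum_congr rfl fun i _ => ?_
    generalize K (swapPair s q) = k
    cases h : s i <;> simp [swapPair, boolSign, h] <;> ring
  have h1 : ∀ q, ∑ s, Q (swapPair s q) ≤ 2 ^ n * (2 * B) := by
    intro q
    rw [Finset.sum_congr rfl fun s _ => hswap s q, Finset.sum_add_distrib]
    have h2 := hrad q.2 fun s => K (swapPair s q)
    -- The first tuple enters with opposite signs, so its selection is indexed by the flipped signs.
    have h3 := hrad q.1 fun s => K (swapPair (fun i => !s i) q)
    rw [← sum_flip_signs] at h3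
    simp only [Bool.not_not] at h3
    linarith
  have h2 : 2 ^ n * ∑ q, Q q = ∑ q, ∑ s, Q (swapPair s q) := by
    have : ∀ s : Fin n → Bool, ∑ q, Q (swapPair s q) = ∑ q, Q q :=
      fun s => Fintype.sum_bijective _ (swapPair_involutive s).bijective _ _ fun _ => rfl
    rw [Finset.sum_comm (f := fun q s => Q (swapPair s q)),
      Finset.sum_congr rfl fun s _ => this s, Finset.sum_const, nsmul_eq_mul]
    simp [Finset.card_univ]
  have h3 : 2 ^ n * ∑ q, Q q
      ≤ 2 ^ n * ((Fintype.card α : ℝ) ^ n * Fintype.card α ^ n * (2 * B)) := by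
    rw [h2]
    refine (Finset.sum_le_sum fun q _ => h1 q).trans_eq ?_
    rw [Finset.sum_const, Finset.card_univ, Fintype.card_prod, nsmul_eq_mul, Nat.cast_mul,
      Fintype.card_fun, Fintype.card_fin, Nat.cast_pow]
    ring
  exact le_of_mul_le_mul_left h3 (by positivity)

/-- If all Rademacher averages of the arrays `a k` along selections `j` are at most `B`, then the
deviation of the selected sum from its mean, for any choice `w` of the array, is at most `2 * B` on
average. -/
lemma sum_deviation_le [Nonempty α]
    (hrad : ∀ (j : Fin n → α) (w : (Fin n → Bool) → κ),
      ∑ s, ∑ i, boolSign (s i) * a (w s) i (j i) ≤ 2 ^ n * B) (w : (Fin n → α) → κ) :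
    ∑ j, ∑ i, ((∑ l, a (w j) i l) / Fintype.card α - a (w j) i (j i))
      ≤ Fintype.card α ^ n * (2 * B) := by
  have hc : (0 : ℝ) < Fintype.card α := by exact_mod_cast Fintype.card_pos
  have hmean : ∀ j, Fintype.card α ^ n
      * ∑ i, ((∑ l, a (w j) i l) / Fintype.card α - a (w j) i (j i))
      = ∑ j' : Fin n → α, ∑ i, (a (w j) i (j' i) - a (w j) i (j i)) := by
    intro j
    rw [Finset.sum_comm, Finset.mul_sum]
    refine Finset.sum_congr rfl fun i _ => ?_
    rw [Finset.sum_sub_distrib, sum_apply_eq_card_pow_mul_mean i (a (w j) i), Finset.sum_const,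
      Finset.card_univ, nsmul_eq_mul, Fintype.card_fun, Fintype.card_fin, Nat.cast_pow]
    ring
  refine le_of_mul_le_mul_left ?_ (pow_pos hc n)
  rw [Finset.mul_sum, Finset.sum_congr rfl fun j _ => hmean j]
  have h := sum_selected_difference_le a hrad fun q => w q.1
  rw [Fintype.sum_prod_type, mul_assoc] at h
  exact h

/-- Exponential deviation bound for a data-dependent choice `w` from a finite class. -/
theorem sum_exp_deviation_le [Nonempty α] [Finite κ] [Nonempty κ]
    (ha : ∀ k i l, 0 ≤ a k i l ∧ a k i l ≤ 1)
    (hrad : ∀ (j : Fin n → α) (w : (Fin n → Bool) → κ),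
      ∑ s, ∑ i, boolSign (s i) * a (w s) i (j i) ≤ 2 ^ n * B) {t : ℝ} (ht : 0 ≤ t)
    (w : (Fin n → α) → κ) :
    ∑ j, Real.exp (t * ∑ i, ((∑ l, a (w j) i l) / Fintype.card α - a (w j) i (j i)))
      ≤ Fintype.card α ^ n * Real.exp (t * (2 * B) + n * t ^ 2 / 8) := by
  have hc : (0 : ℝ) < Fintype.card α := by exact_mod_cast Fintype.card_pos
  let D : κ → (Fin n → α) → ℝ :=
    fun k j => ∑ i, ((∑ l, a k i l) / Fintype.card α - a k i (j i))
  -- The maximal deviation has bounded differences, whereas an arbitrary choice `w` may change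
  -- abruptly with one coordinate.
  choose K hK using fun j => Finite.exists_max fun k => D k j
  have hdiff : ∀ i j b, D (K (Function.update j i b)) (Function.update j i b) - D (K j) j ≤ 1 := by
    intro i j b
    set k := K (Function.update j i b)
    have h1 : D k (Function.update j i b) - D k j = a k i (j i) - a k i b := by
      simp only [D]
      rw [← Finset.sum_sub_distrib, Finset.sum_eq_single i]
      · simp
      · intro l _ hl; simp [Function.update_of_ne hl]
      · simp
    linarith [hK j k, (ha k i (j i)).2, (ha k i b).1]
  calc ∑ j, Real.exp (t * D (w j) j) ≤ ∑ j, Real.exp (t * D (K j) j) := by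
        gcongr with j; exact hK j (w j)
    _ ≤ _ := sum_exp_le_of_bounded_differences t n (fun j => D (K j) j) hdiff
    _ ≤ _ := by
        gcongr
        rw [div_le_iff₀ (by positivity), mul_comm]
        exact sum_deviation_le a hrad K

end Symmetrization

/-! ### Exponential moments of the generalization gap -/

section ProductSelection

variable {U α : Type*} [MeasurableSpace U] {n : ℕ} (ν : Fin n → Measure U)
  [∀ i, IsProbabilityMeasure (ν i)]

/-- Choose the entry `j i` from the `i`-th row of an array. -/
def selectEntries (j : Fin n → α) (z : Fin n × α → U) : Fin n → U := fun i => z (i, j i)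

lemma measurable_selectEntries (j : Fin n → α) :
    Measurable (selectEntries j : (Fin n × α → U) → Fin n → U) :=
  measurable_pi_lambda _ fun _ => measurable_pi_apply _

variable [Fintype α]

lemma iIndepFun_entries :
    iIndepFun (fun (q : Fin n × α) (z : Fin n × α → U) => z q)
      (Measure.pi fun q : Fin n × α => ν q.1) :=
  iIndepFun_pi (X := fun _ u => u) fun _ => aemeasurable_id

lemma map_selectEntries (j : Fin n → α) :
    (Measure.pi fun q : Fin n × α => ν q.1).map (selectEntries j) = Measure.pi ν := by
  have h := (iIndepFun_entries (α := α) ν).precomp (g := fun i => (i, j i))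
    fun i i' h => congrArg Prod.fst h
  rw [iIndepFun_iff_map_fun_eq_pi_map fun i => (measurable_pi_apply _).aemeasurable] at h
  refine h.trans ?_
  congr 1
  funext i
  exact (measurePreserving_eval (fun q : Fin n × α => ν q.1) (i, j i)).map_eq

lemma map_selectEntries_prod_entry (j : Fin n → α) {i : Fin n} {l : α} (hl : l ≠ j i) :
    (Measure.pi fun q : Fin n × α => ν q.1).map (fun z => (selectEntries j z, z (i, l)))
      = (Measure.pi ν).prod (ν i) := by
  classical
  set S : Finset (Fin n × α) := Finset.univ.image fun i => (i, j i)
  have hS : ∀ i, (i, j i) ∈ S := fun i => Finset.mem_image_of_mem _ (Finset.mem_univ i)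
  have hdisj : Disjoint S {(i, l)} := by
    rw [Finset.disjoint_singleton_right]
    intro h
    obtain ⟨i', -, h'⟩ := Finset.mem_image.1 h
    simp only [Prod.mk.injEq] at h'
    obtain ⟨rfl, rfl⟩ := h'
    exact hl rfl
  have h := (iIndepFun_entries (α := α) ν).indepFun_finset S {(i, l)} hdisj
    fun q => measurable_pi_apply q
  have h2 : IndepFun (selectEntries j) (fun z : Fin n × α → U => z (i, l))
      (Measure.pi fun q : Fin n × α => ν q.1) :=
    h.comp (φ := fun (y : S → U) (i : Fin n) => y ⟨(i, j i), hS i⟩)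
      (ψ := fun y : ({(i, l)} : Finset (Fin n × α)) → U => y ⟨(i, l), Finset.mem_singleton_self _⟩)
      (measurable_pi_lambda _ fun _ => measurable_pi_apply _) (measurable_pi_apply _)
  rw [indepFun_iff_map_prod_eq_prod_map_map (measurable_selectEntries j).aemeasurable
    (measurable_pi_apply _).aemeasurable, map_selectEntries] at h2
  rw [h2]
  congr 1
  exact (measurePreserving_eval (fun q : Fin n × α => ν q.1) (i, l)).map_eq

end ProductSelection

section ExpMoment

variable {U : Type*} [MeasurableSpace U] {n : ℕ} (ν : Fin n → Measure U)

/-- The sum over the sample of the differences between means and observed values of the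
data-dependent function `φ z`. -/
def meanGap (φ : (Fin n → U) → U → ℝ) (z : Fin n → U) : ℝ :=
  ∑ i, (∫ u, φ z u ∂ν i - φ z (z i))

/-- The selected entry contributes a 1 / |α| share of its own row average, hence the factor 1 - 1 /
|α|; the remainder consists of centered unselected entries. -/
lemma selected_deviation_eq {α : Type*} [Fintype α] [Nonempty α] [DecidableEq α]
    {φ : (Fin n → U) → U → ℝ} (j : Fin n → α) (z : Fin n × α → U) :
    ∑ i, ((∑ l, φ (selectEntries j z) (z (i, l))) / Fintype.card α
        - φ (selectEntries j z) (z (i, j i)))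
      = (1 - 1 / Fintype.card α) * meanGap ν φ (selectEntries j z)
        + 1 / Fintype.card α * ∑ i, ∑ l, if l = j i then 0 else
          (φ (selectEntries j z) (z (i, l)) - ∫ u, φ (selectEntries j z) u ∂ν i) := by
  have hc : (Fintype.card α : ℝ) ≠ 0 := by exact_mod_cast Fintype.card_ne_zero
  rw [meanGap, Finset.mul_sum, Finset.mul_sum, ← Finset.sum_add_distrib]
  refine Finset.sum_congr rfl fun i _ => ?_
  have h : ∑ l, (if l = j i then 0 else
      (φ (selectEntries j z) (z (i, l)) - ∫ u, φ (selectEntries j z) u ∂ν i))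
      = ∑ l, (φ (selectEntries j z) (z (i, l)) - ∫ u, φ (selectEntries j z) u ∂ν i)
        - (φ (selectEntries j z) (z (i, j i)) - ∫ u, φ (selectEntries j z) u ∂ν i) := by
    rw [eq_sub_iff_add_eq, ← Finset.sum_erase_add _ _ (Finset.mem_univ (j i)),
      ← Finset.sum_erase_add (a := j i) _ _ (Finset.mem_univ (j i)), if_pos rfl, add_zero]
    congr 1
    exact Finset.sum_congr rfl fun l hl => if_neg (Finset.ne_of_mem_erase hl)
  rw [h, Finset.sum_sub_distrib, Finset.sum_const, Finset.card_univ, nsmul_eq_mul]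
  change _ = (1 - 1 / (Fintype.card α : ℝ)) * (_ - φ _ (z (i, j i))) + _
  field_simp
  ring

variable [∀ i, IsProbabilityMeasure (ν i)] {φ : (Fin n → U) → U → ℝ}

lemma integrable_exp_of_abs_le {Ω : Type*} [MeasurableSpace Ω] {μ : Measure Ω} [IsFiniteMeasure μ]
    {f : Ω → ℝ} (hf : Measurable f) {C : ℝ} (hC : ∀ ω, |f ω| ≤ C) :
    Integrable (fun ω => Real.exp (f ω)) μ :=
  Integrable.of_bound hf.exp.aestronglyMeasurable (Real.exp C) <| .of_forall fun ω => by
    rw [Real.norm_eq_abs, Real.abs_exp]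
    exact Real.exp_le_exp.2 ((le_abs_self _).trans (hC ω))

lemma measurable_integral_section (hφ : Measurable (Function.uncurry φ)) (i : Fin n) :
    Measurable fun z => ∫ u, φ z u ∂ν i :=
  hφ.stronglyMeasurable.integral_prod_right.measurable

lemma measurable_meanGap (hφ : Measurable (Function.uncurry φ)) : Measurable (meanGap ν φ) :=
  Finset.measurable_fun_sum _ fun i _ => (measurable_integral_section ν hφ i).sub
    (hφ.comp (measurable_id.prodMk (measurable_pi_apply i)))

lemma integral_section_mem_Icc (hφ : Measurable (Function.uncurry φ))
    (hφ01 : ∀ z u, 0 ≤ φ z u ∧ φ z u ≤ 1) (z : Fin n → U) (i : Fin n) :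
    0 ≤ ∫ u, φ z u ∂ν i ∧ ∫ u, φ z u ∂ν i ≤ 1 := by
  refine ⟨integral_nonneg fun u => (hφ01 z u).1, ?_⟩
  have hint : Integrable (φ z) (ν i) :=
    Integrable.of_mem_Icc 0 1 (hφ.comp measurable_prodMk_left).aemeasurable (.of_forall (hφ01 z))
  calc ∫ u, φ z u ∂ν i ≤ ∫ _, (1 : ℝ) ∂ν i :=
        integral_mono hint (integrable_const _) fun u => (hφ01 z u).2
    _ = 1 := by simp

lemma abs_meanGap_le (hφ : Measurable (Function.uncurry φ))
    (hφ01 : ∀ z u, 0 ≤ φ z u ∧ φ z u ≤ 1) (z : Fin n → U) : |meanGap ν φ z| ≤ n := by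
  refine (Finset.abs_sum_le_sum_abs _ _).trans ?_
  calc ∑ i, |∫ u, φ z u ∂ν i - φ z (z i)| ≤ ∑ _i : Fin n, (1 : ℝ) := by
        refine Finset.sum_le_sum fun i _ => ?_
        have h1 := integral_section_mem_Icc ν hφ hφ01 z i
        have h2 := hφ01 z (z i)
        rw [abs_le]
        constructor <;> linarith
    _ = n := by simp

variable {α : Type*} [Fintype α]

/-- The function is determined by the selected entries, and an unselected entry is a fresh draw
independent of them. -/
lemma integral_selected_mul_centered_entry_eq_zero (hφ : Measurable (Function.uncurry φ))
    (hφ01 : ∀ z u, 0 ≤ φ z u ∧ φ z u ≤ 1) {g : (Fin n → U) → ℝ} (hg : Measurable g) {C : ℝ}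
    (hC : ∀ z, |g z| ≤ C) (j : Fin n → α) {i : Fin n} {l : α} (hl : l ≠ j i) :
    Integrable (fun z : Fin n × α → U => g (selectEntries j z) *
        (φ (selectEntries j z) (z (i, l)) - ∫ u, φ (selectEntries j z) u ∂ν i))
        (Measure.pi fun q : Fin n × α => ν q.1) ∧
      ∫ z : Fin n × α → U, g (selectEntries j z) *
        (φ (selectEntries j z) (z (i, l)) - ∫ u, φ (selectEntries j z) u ∂ν i)
        ∂(Measure.pi fun q : Fin n × α => ν q.1) = 0 := by
  set F : (Fin n → U) × U → ℝ := fun y => g y.1 * (φ y.1 y.2 - ∫ u, φ y.1 u ∂ν i) with hF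
  have hFm : Measurable F := (hg.comp measurable_fst).mul
    (hφ.sub ((measurable_integral_section ν hφ i).comp measurable_fst))
  have hFb : ∀ y, ‖F y‖ ≤ C := fun y => by
    rw [hF, Real.norm_eq_abs, abs_mul, ← mul_one C]
    have h1 := integral_section_mem_Icc ν hφ hφ01 y.1 i
    have h2 := hφ01 y.1 y.2
    have h3 : |φ y.1 y.2 - ∫ u, φ y.1 u ∂ν i| ≤ 1 := by
      rw [abs_le]; constructor <;> linarith
    exact mul_le_mul (hC _) h3 (abs_nonneg _) ((abs_nonneg _).trans (hC y.1))
  have hm : Measurable fun z : Fin n × α → U => (selectEntries j z, z (i, l)) :=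
    (measurable_selectEntries j).prodMk (measurable_pi_apply _)
  refine ⟨Integrable.of_bound (hFm.comp hm).aestronglyMeasurable C
    (.of_forall fun z => hFb (selectEntries j z, z (i, l))), ?_⟩
  have h1 := integral_map (μ := Measure.pi fun q : Fin n × α => ν q.1) hm.aemeasurable
    (f := F) hFm.aestronglyMeasurable
  rw [map_selectEntries_prod_entry ν j hl] at h1
  refine h1.symm.trans ?_
  rw [integral_prod F (Integrable.of_bound hFm.aestronglyMeasurable C (.of_forall hFb))]
  have h2 : ∀ z, ∫ u, F (z, u) ∂ν i = 0 := fun z => by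
    have hint : Integrable (φ z) (ν i) :=
      Integrable.of_mem_Icc 0 1 (hφ.comp measurable_prodMk_left).aemeasurable (.of_forall (hφ01 z))
    simp only [hF]
    rw [integral_const_mul, integral_sub hint (integrable_const _)]
    simp
  simp [h2]

lemma integrable_exp_selected_deviation [Nonempty α] (hφ : Measurable (Function.uncurry φ))
    (hφ01 : ∀ z u, 0 ≤ φ z u ∧ φ z u ≤ 1) (t : ℝ) (j : Fin n → α) :
    Integrable (fun z : Fin n × α → U =>
      Real.exp (t * ∑ i, ((∑ l, φ (selectEntries j z) (z (i, l))) / Fintype.card α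
        - φ (selectEntries j z) (z (i, j i)))))
      (Measure.pi fun q : Fin n × α => ν q.1) := by
  have hc : (0 : ℝ) < Fintype.card α := by exact_mod_cast Fintype.card_pos
  have hm : ∀ q, Measurable fun z : Fin n × α → U => φ (selectEntries j z) (z q) := fun q =>
    hφ.comp ((measurable_selectEntries j).prodMk (measurable_pi_apply q))
  refine integrable_exp_of_abs_le (C := |t| * n) (Measurable.const_mul
    (Finset.measurable_fun_sum _ fun i _ =>
      ((Finset.measurable_fun_sum _ fun l _ => hm (i, l)).div_const _).sub (hm _)) t) fun z => ?_
  rw [abs_mul]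
  gcongr
  refine (Finset.abs_sum_le_sum_abs _ _).trans ?_
  calc _ ≤ ∑ _i : Fin n, (1 : ℝ) := by
        refine Finset.sum_le_sum fun i _ => ?_
        have h1 : 0 ≤ (∑ l, φ (selectEntries j z) (z (i, l))) / Fintype.card α :=
          div_nonneg (Finset.sum_nonneg fun l _ => (hφ01 _ _).1) hc.le
        have h2 : (∑ l, φ (selectEntries j z) (z (i, l))) / Fintype.card α ≤ 1 := by
          rw [div_le_one hc]
          calc _ ≤ ∑ _l : α, (1 : ℝ) := Finset.sum_le_sum fun l _ => (hφ01 _ _).2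
            _ = _ := by simp
        have h3 := hφ01 (selectEntries j z) (z (i, j i))
        rw [abs_le]
        constructor <;> linarith
    _ = n := by simp

/-- Jensen's inequality for averaging over the entries of the array that are not selected. -/
lemma integral_exp_meanGap_le [Nonempty α] (hφ : Measurable (Function.uncurry φ))
    (hφ01 : ∀ z u, 0 ≤ φ z u ∧ φ z u ≤ 1) (t : ℝ) (j : Fin n → α) :
    ∫ z, Real.exp (t * ((1 - 1 / Fintype.card α) * meanGap ν φ z)) ∂Measure.pi ν
      ≤ ∫ z, Real.exp (t * ∑ i, ((∑ l, φ (selectEntries j z) (z (i, l))) / Fintype.card α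
        - φ (selectEntries j z) (z (i, j i)))) ∂(Measure.pi fun q : Fin n × α => ν q.1) := by
  classical
  set c : ℝ := 1 - 1 / Fintype.card α with hcdef
  set g : (Fin n → U) → ℝ := fun z => Real.exp (t * (c * meanGap ν φ z)) with hg
  have hm : Measurable fun z => t * (c * meanGap ν φ z) :=
    ((measurable_meanGap ν hφ).const_mul c).const_mul t
  have habs : ∀ z, |t * (c * meanGap ν φ z)| ≤ |t| * (|c| * n) := fun z => by
    rw [abs_mul, abs_mul]
    gcongr
    exact abs_meanGap_le ν hφ hφ01 z
  have hgb : ∀ z, |g z| ≤ Real.exp (|t| * (|c| * n)) := fun z => by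
    rw [hg, Real.abs_exp]
    exact Real.exp_le_exp.2 ((le_abs_self _).trans (habs z))
  set R : Fin n → α → (Fin n × α → U) → ℝ := fun i l z => if l = j i then 0 else
    g (selectEntries j z) *
      (φ (selectEntries j z) (z (i, l)) - ∫ u, φ (selectEntries j z) u ∂ν i) with hR
  have hRint : ∀ i l, Integrable (R i l) (Measure.pi fun q : Fin n × α => ν q.1) ∧
      ∫ z, R i l z ∂(Measure.pi fun q : Fin n × α => ν q.1) = 0 := by
    intro i l
    by_cases hl : l = j i
    · simp [hR, hl]
    · simpa [hR, hl] using
        integral_selected_mul_centered_entry_eq_zero ν hφ hφ01 hm.exp hgb j hl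
  -- Conditional Jensen by hand: exp (x + y) ≥ exp x * (1 + y), and the part linear in `y`
  -- integrates to zero.
  have hpt : ∀ z : Fin n × α → U,
      g (selectEntries j z) + t * (1 / Fintype.card α) * ∑ i, ∑ l, R i l z
      ≤ Real.exp (t * ∑ i, ((∑ l, φ (selectEntries j z) (z (i, l))) / Fintype.card α
        - φ (selectEntries j z) (z (i, j i)))) := by
    intro z
    rw [selected_deviation_eq ν j z, mul_add, Real.exp_add]
    have h1 : ∑ i, ∑ l, R i l z = g (selectEntries j z) * ∑ i, ∑ l, if l = j i then 0 else
        (φ (selectEntries j z) (z (i, l)) - ∫ u, φ (selectEntries j z) u ∂ν i) := by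
      rw [Finset.mul_sum]
      refine Finset.sum_congr rfl fun i _ => ?_
      rw [Finset.mul_sum]
      refine Finset.sum_congr rfl fun l _ => ?_
      simp only [hR]
      split_ifs <;> simp
    rw [h1]
    set y := ∑ i, ∑ l, if l = j i then 0 else
        (φ (selectEntries j z) (z (i, l)) - ∫ u, φ (selectEntries j z) u ∂ν i)
    have h2 := Real.add_one_le_exp (t * (1 / Fintype.card α * y))
    have h3 : 0 < g (selectEntries j z) := Real.exp_pos _
    calc _ = g (selectEntries j z) * (t * (1 / Fintype.card α * y) + 1) := by ring
      _ ≤ _ := mul_le_mul_of_nonneg_left h2 h3.le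
  have hgint : Integrable (fun z : Fin n × α → U => g (selectEntries j z))
      (Measure.pi fun q : Fin n × α => ν q.1) :=
    integrable_exp_of_abs_le (hm.comp (measurable_selectEntries j)) fun z => habs _
  have hsumint : Integrable (fun z : Fin n × α → U => ∑ i, ∑ l, R i l z)
      (Measure.pi fun q : Fin n × α => ν q.1) :=
    integrable_finsetSum _ fun i _ => integrable_finsetSum _ fun l _ => (hRint i l).1
  have hsum0 : ∫ z, ∑ i, ∑ l, R i l z ∂(Measure.pi fun q : Fin n × α => ν q.1) = 0 := by
    rw [integral_finsetSum _ fun i _ => integrable_finsetSum _ fun l _ => (hRint i l).1]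
    refine Finset.sum_eq_zero fun i _ => ?_
    rw [integral_finsetSum _ fun l _ => (hRint i l).1]
    exact Finset.sum_eq_zero fun l _ => (hRint i l).2
  calc ∫ z, g z ∂Measure.pi ν
      = ∫ z, g (selectEntries j z) ∂(Measure.pi fun q : Fin n × α => ν q.1) := by
        rw [← map_selectEntries ν j, integral_map (measurable_selectEntries j).aemeasurable
          hm.exp.aestronglyMeasurable]
    _ = ∫ z, (g (selectEntries j z) + t * (1 / Fintype.card α) * ∑ i, ∑ l, R i l z)
          ∂(Measure.pi fun q : Fin n × α => ν q.1) := by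
        rw [integral_add hgint (hsumint.const_mul _), integral_const_mul, hsum0]
        simp
    _ ≤ _ := integral_mono (hgint.add (hsumint.const_mul _))
        (integrable_exp_selected_deviation ν hφ hφ01 t j) hpt

/-- Exponential moment bound for the generalization gap of a data-dependent function whose
Rademacher averages are bounded by `B`. -/
theorem integral_exp_meanGap_le_of_rademacher (α : Type*) [Fintype α] [Nonempty α]
    (hφ : Measurable (Function.uncurry φ)) (hφ01 : ∀ z u, 0 ≤ φ z u ∧ φ z u ≤ 1) {B : ℝ}
    (hrad : ∀ (x : Fin n → U) (w : (Fin n → Bool) → Fin n → U),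
      ∑ s, ∑ i, boolSign (s i) * φ (w s) (x i) ≤ 2 ^ n * B) {t : ℝ} (ht : 0 ≤ t) :
    ∫ z, Real.exp (t * ((1 - 1 / Fintype.card α) * meanGap ν φ z)) ∂Measure.pi ν
      ≤ Real.exp (t * (2 * B) + n * t ^ 2 / 8) := by
  have hc : (0 : ℝ) < Fintype.card α := by exact_mod_cast Fintype.card_pos
  set I := ∫ z, Real.exp (t * ((1 - 1 / Fintype.card α) * meanGap ν φ z)) ∂Measure.pi ν
  have hint := integrable_exp_selected_deviation (α := α) ν hφ hφ01 t
  refine le_of_mul_le_mul_left ?_ (pow_pos hc n)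
  -- Every selection has the law of the sample, so `I` may be averaged over `j`. For a fixed array
  -- the functions are indexed by the selections they are computed from, and the choice made at `j`
  -- is `j` itself.
  calc (Fintype.card α : ℝ) ^ n * I = ∑ _j : Fin n → α, I := by simp
    _ ≤ _ := Finset.sum_le_sum fun j _ => integral_exp_meanGap_le ν hφ hφ01 t j
    _ = _ := (integral_finsetSum _ fun j _ => hint j).symm
    _ ≤ ∫ _, (Fintype.card α : ℝ) ^ n * Real.exp (t * (2 * B) + n * t ^ 2 / 8)
          ∂(Measure.pi fun q : Fin n × α => ν q.1) :=
        integral_mono (integrable_finsetSum _ fun j _ => hint j) (integrable_const _) fun z =>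
          sum_exp_deviation_le (fun (k : Fin n → α) i l => φ (selectEntries k z) (z (i, l)))
            (fun k i l => hφ01 _ _)
            (fun j w => hrad (fun i => z (i, j i)) fun s => selectEntries (w s) z) ht id
    _ = _ := by simp

/-- Tail bound for the generalization gap of a data-dependent function. -/
theorem measureReal_meanGap_gt_le (hn : 0 < n) (hφ : Measurable (Function.uncurry φ))
    (hφ01 : ∀ z u, 0 ≤ φ z u ∧ φ z u ≤ 1) {B : ℝ}
    (hrad : ∀ (x : Fin n → U) (w : (Fin n → Bool) → Fin n → U),
      ∑ s, ∑ i, boolSign (s i) * φ (w s) (x i) ≤ 2 ^ n * B) {L : ℝ} (hL : 0 ≤ L) :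
    (Measure.pi ν).real {z | √(16 * (2 * B) ^ 2 + n * L) < meanGap ν φ z} ≤ Real.exp (-L) := by
  set r := √(16 * (2 * B) ^ 2 + n * L) with hr
  have hn0 : (0 : ℝ) < n := by exact_mod_cast hn
  have hr2 : r ^ 2 = 16 * (2 * B) ^ 2 + n * L := Real.sq_sqrt (by positivity)
  have hr0 : 0 ≤ r := Real.sqrt_nonneg _
  -- `d` is the part of `3 / 4 * r` that is left for the fluctuations
  set d := 3 / 4 * r - 2 * B with hd
  have hd0 : 0 ≤ d := by
    have : 2 * B ≤ 3 / 4 * r := by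
      apply abs_le_of_sq_le_sq' _ (by positivity) |>.2
      nlinarith [mul_nonneg hn0.le hL, sq_nonneg B]
    linarith
  have hdL : n * L ≤ 2 * d ^ 2 := by
    -- The constant 16 in `r` is the one that makes this a perfect square.
    have : 2 * d ^ 2 - n * L = (r - 12 * (2 * B)) ^ 2 / 8 := by
      rw [hd, show (n : ℝ) * L = r ^ 2 - 16 * (2 * B) ^ 2 by linarith]; ring
    have := sq_nonneg (r - 12 * (2 * B))
    linarith
  -- Minimizer of the Chernoff exponent n t ^ 2 / 8 - t d.
  set t := 4 * d / n with ht
  have ht0 : 0 ≤ t := by positivity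
  have h := integral_exp_meanGap_le_of_rademacher ν (Fin 4) hφ hφ01 hrad ht0
  simp only [Fintype.card_fin] at h
  norm_num at h
  set X : (Fin n → U) → ℝ := fun z => t * (3 / 4 * meanGap ν φ z) with hX
  have hXint : Integrable (fun z => Real.exp (X z)) (Measure.pi ν) := by
    refine integrable_exp_of_abs_le (C := |t| * (|3 / 4| * n))
      (((measurable_meanGap ν hφ).const_mul _).const_mul _) fun z => ?_
    rw [hX, abs_mul, abs_mul]
    gcongr
    exact abs_meanGap_le ν hφ hφ01 z
  have h2 := mul_meas_ge_le_integral_of_nonneg (μ := Measure.pi ν)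
    (.of_forall fun z => (Real.exp_pos (X z)).le) hXint (Real.exp (t * (3 / 4 * r)))
  have h3 : (Measure.pi ν).real {z | r < meanGap ν φ z}
      ≤ (Measure.pi ν).real {z | Real.exp (t * (3 / 4 * r)) ≤ Real.exp (X z)} := by
    refine measureReal_mono fun z (hz : r < _) => ?_
    simp only [Set.mem_ofPred_eq, hX]
    gcongr
  have h4 : t * (2 * B) + n * t ^ 2 / 8 - t * (3 / 4 * r) ≤ -L := by
    have : t * (2 * B) + n * t ^ 2 / 8 - t * (3 / 4 * r) = -(2 * d ^ 2 / n) := by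
      rw [show 3 / 4 * r = d + 2 * B by rw [hd]; ring, ht]
      field_simp
      ring
    rw [this, neg_le_neg_iff, le_div_iff₀ hn0]
    linarith
  have h5 : Real.exp (t * (3 / 4 * r)) * (Measure.pi ν).real {z | r < meanGap ν φ z}
      ≤ Real.exp (t * (2 * B) + n * t ^ 2 / 8) :=
    (mul_le_mul_of_nonneg_left h3 (Real.exp_pos _).le).trans (h2.trans h)
  calc _ ≤ Real.exp (t * (2 * B) + n * t ^ 2 / 8) / Real.exp (t * (3 / 4 * r)) := by
        rw [le_div_iff₀ (Real.exp_pos _)]; linarith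
    _ = Real.exp (t * (2 * B) + n * t ^ 2 / 8 - t * (3 / 4 * r)) := (Real.exp_sub _ _).symm
    _ ≤ _ := Real.exp_le_exp.2 h4

end ExpMoment

/-! ### Total variation -/

lemma abs_sub_le_tvNorm {S : Type*} [MeasurableSpace S] (ν μ : Measure S) [IsProbabilityMeasure ν]
    [IsProbabilityMeasure μ] {A : Set S} (hA : MeasurableSet A) :
    |ν.real A - μ.real A| ≤ tvNorm ν μ := by
  -- An unbounded real supremum has the default value 0, so boundedness must be checked.
  have hbdd : BddAbove (Set.range fun A : {A : Set S // MeasurableSet A} =>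
      |ν.real A.1 - μ.real A.1|) := by
    refine ⟨1, ?_⟩
    rintro _ ⟨A, rfl⟩
    have h1 := measureReal_le_one (μ := ν) (s := A.1)
    have h2 := measureReal_le_one (μ := μ) (s := A.1)
    have h3 := measureReal_nonneg (μ := ν) (s := A.1)
    have h4 := measureReal_nonneg (μ := μ) (s := A.1)
    dsimp only
    rw [abs_le]
    constructor <;> linarith
  have h := le_ciSup hbdd ⟨A, hA⟩
  dsimp only at h
  rw [tvNorm]
  linarith [abs_nonneg (ν.real A - μ.real A)]

lemma tvNorm_nonneg {S : Type*} [MeasurableSpace S] (ν μ : Measure S) : 0 ≤ tvNorm ν μ :=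
  mul_nonneg zero_le_two (Real.iSup_nonneg fun _ => abs_nonneg _)

/-- Layer cake: the integral of a [0, 1]-valued function averages the measures of its superlevel
sets. The factor 2 in `tvNorm` is slack here. -/
lemma integral_le_integral_add_tvNorm {S : Type*} [MeasurableSpace S] (ν μ : Measure S)
    [IsProbabilityMeasure ν] [IsProbabilityMeasure μ] {h : S → ℝ} (hm : Measurable h)
    (h01 : ∀ x, 0 ≤ h x ∧ h x ≤ 1) : ∫ x, h x ∂μ ≤ ∫ x, h x ∂ν + tvNorm ν μ := by
  have hlayer : ∀ (ρ : Measure S) [IsProbabilityMeasure ρ],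
      IntegrableOn (fun t => ρ.real {x | t ≤ h x}) (Set.Ioc (0 : ℝ) 1) ∧
      ∫ x, h x ∂ρ = ∫ t in Set.Ioc (0 : ℝ) 1, ρ.real {x | t ≤ h x} := by
    intro ρ _
    constructor
    · refine Integrable.of_mem_Icc 0 1 (Antitone.measurable fun s t hst => ?_).aemeasurable
        (.of_forall fun t => ⟨measureReal_nonneg, measureReal_le_one⟩)
      exact measureReal_mono fun x (hx : t ≤ h x) => hst.trans hx
    · exact (Integrable.of_mem_Icc 0 1 hm.aemeasurable
        (.of_forall h01)).integral_eq_integral_Ioc_meas_le (.of_forall fun x => (h01 x).1)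
        (.of_forall fun x => (h01 x).2)
  rw [(hlayer μ).2, (hlayer ν).2]
  calc ∫ t in Set.Ioc (0 : ℝ) 1, μ.real {x | t ≤ h x}
      ≤ ∫ t in Set.Ioc (0 : ℝ) 1, (ν.real {x | t ≤ h x} + tvNorm ν μ) := by
        refine integral_mono (hlayer μ).1 ((hlayer ν).1.add (integrable_const _)) fun t => ?_
        have := abs_sub_le_tvNorm ν μ (measurableSet_le (measurable_const (a := t)) hm)
        dsimp only
        linarith [(abs_le.1 this).1]
    _ = _ := by
        rw [integral_add (hlayer ν).1 (integrable_const _)]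
        simp

/-! ### Generalization gap of a sample of pairs -/

section Pairs

variable {S : Type*} {n : ℕ}

/-- The average of `g` over the two entries of a pair. -/
def pairMean (g : S → ℝ) (u : S × S) : ℝ := (g u.1 + g u.2) / 2

/-- Both entries of a pair share one sign, so the sum is the mean of two Rademacher sums over n
points each, and the constant is unchanged. -/
lemma rademacher_pairMean_le {V : ℕ} (hV : 0 < V) (hn : 0 < n) {F : Set (S → ℝ)}
    (hF : vcDim F ≤ V) (hF01 : ∀ h ∈ F, ∀ x, 0 ≤ h x ∧ h x ≤ 1) (x : Fin n → S × S)
    (w : (Fin n → Bool) → S → ℝ) (hw : ∀ s, w s ∈ F) :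
    ∑ s, ∑ i, boolSign (s i) * pairMean (w s) (x i) ≤ 2 ^ n * (40 * √(n * V)) := by
  have : Nonempty (Fin n) := ⟨⟨0, hn⟩⟩
  have h1 := sum_signed_le_of_vcDim_le hV hF hF01 (fun i => (x i).1) w hw
  have h2 := sum_signed_le_of_vcDim_le hV hF hF01 (fun i => (x i).2) w hw
  rw [Fintype.card_fin] at h1 h2
  have h3 : ∑ s, ∑ i, boolSign (s i) * pairMean (w s) (x i)
      = (∑ s, ∑ i, boolSign (s i) * w s (x i).1 + ∑ s, ∑ i, boolSign (s i) * w s (x i).2) / 2 := by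
    rw [← Finset.sum_add_distrib, Finset.sum_div]
    refine Finset.sum_congr rfl fun s _ => ?_
    rw [← Finset.sum_add_distrib, Finset.sum_div]
    exact Finset.sum_congr rfl fun i _ => by rw [pairMean]; ring
  rw [h3]
  linarith

lemma sqrt_gap_eq (hn : 0 < n) (V : ℕ) (L : ℝ) :
    √(16 * (2 * (40 * √(n * V))) ^ 2 + n * L) = n * √((4 * V * 25600 + L) / n) := by
  have hn0 : (0 : ℝ) < n := by exact_mod_cast hn
  rw [mul_pow, mul_pow, Real.sq_sqrt (by positivity), show (n : ℝ) * √((4 * V * 25600 + L) / n)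
    = √((n : ℝ) ^ 2) * √((4 * V * 25600 + L) / n) by rw [Real.sqrt_sq hn0.le],
    ← Real.sqrt_mul (by positivity)]
  congr 1
  field_simp
  ring

variable [MeasurableSpace S]

lemma integral_pairMean {p q : Measure S} [IsProbabilityMeasure p] [IsProbabilityMeasure q]
    {ν : Measure (S × S)} (h1 : ν.map Prod.fst = p) (h2 : ν.map Prod.snd = q) {g : S → ℝ}
    (hg : Measurable g) (hg01 : ∀ x, 0 ≤ g x ∧ g x ≤ 1) :
    ∫ u, pairMean g u ∂ν = (∫ x, g x ∂p + ∫ x, g x ∂q) / 2 := by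
  have hi : ∀ (ρ : Measure S) [IsProbabilityMeasure ρ], Integrable g ρ := fun ρ _ =>
    Integrable.of_mem_Icc 0 1 hg.aemeasurable (.of_forall hg01)
  have hp := hi p
  have hq := hi q
  rw [← h1] at hp
  rw [← h2] at hq
  have hp' : Integrable (fun u : S × S => g u.1) ν := hp.comp_measurable measurable_fst
  have hq' : Integrable (fun u : S × S => g u.2) ν := hq.comp_measurable measurable_snd
  simp only [pairMean]
  rw [integral_div, integral_add hp' hq', ← h1, ← h2,
    integral_map measurable_fst.aemeasurable hg.aestronglyMeasurable,
    integral_map measurable_snd.aemeasurable hg.aestronglyMeasurable]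

end Pairs

lemma sum_elim_div_card {S : Type*} {n : ℕ} (g : S → ℝ) (x x' : Fin n → S) :
    n * ((∑ i, g (Sum.elim x x' i)) / Fintype.card (Fin n ⊕ Fin n))
      = ∑ i, pairMean g (x i, x' i) := by
  rcases Nat.eq_zero_or_pos n with rfl | hn
  · simp
  have hn0 : (n : ℝ) ≠ 0 := by exact_mod_cast hn.ne'
  simp only [pairMean]
  rw [← Finset.sum_div, Finset.sum_add_distrib, Fintype.sum_sum_type, Fintype.card_sum,
    Fintype.card_fin]
  simp only [Sum.elim_inl, Sum.elim_inr]
  push_cast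
  field_simp
  ring

end Distill

end

theorem theorem2 :
    ∃ c : ℝ, 0 < c ∧
      ∀ {𝒴 Ω : Type*} [MeasurableSpace Ω] (μ : Measure Ω) [IsProbabilityMeasure μ]
        {d : ℕ} {𝒳 : Set (Fin d → ℝ)} (h𝒳 : MeasurableSet 𝒳)
        (p : Measure 𝒳) [IsProbabilityMeasure p]
        (dist : 𝒴 → 𝒴 → ℝ) (f : 𝒳 → 𝒴) (G : Set (𝒳 → 𝒴))
        (_hdist : ∀ g ∈ G, ∀ x, 0 ≤ dist (f x) (g x) ∧ dist (f x) (g x) ≤ 1)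
        (V : ℕ) (_hV : 0 < V) (_hG : Distill.vcDim (Distill.lossClass dist f G) ≤ V)
        (Q : Distill.Conditionals 𝒳) {k : ℕ} (order : PMF (Fin k → Fin d))
        {n : ℕ} (_hn : 0 < n) (X X' : Fin n → Ω → 𝒳)
        (_hX : Distill.IsAugmentedSample μ h𝒳 Q order p X X')
        (student : (Fin n ⊕ Fin n → 𝒳) → 𝒳 → 𝒴)
        (_hmem : ∀ z, student z ∈ G)
        (_hmeas : Measurable fun w : (Fin n ⊕ Fin n → 𝒳) × 𝒳 =>
          dist (f w.2) (student w.1 w.2))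
        (_hmin : ∀ᵐ ω ∂μ, ∀ g ∈ G,
          Distill.empDist dist f (student (Sum.elim (X · ω) (X' · ω))) (Sum.elim (X · ω) (X' · ω))
            ≤ Distill.empDist dist f g (Sum.elim (X · ω) (X' · ω)))
        (δ : ℝ) (_hδ : 0 < δ) (_hδ1 : δ < 1),
        1 - δ ≤ μ.real {ω |
          Distill.popDist dist f (student (Sum.elim (X · ω) (X' · ω))) p ≤
            Distill.empDist dist f (student (Sum.elim (X · ω) (X' · ω)))
                (Sum.elim (X · ω) (X' · ω))
              + √((4 * V * (c + Distill.tvNorm (Distill.gibbsLaw h𝒳 Q order p) p) - Real.log δ) / n)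
              + Distill.tvNorm (Distill.gibbsLaw h𝒳 Q order p) p} := by
  -- 25600 = 16 * (2 * 40) ^ 2 / 4, with 40 from chaining, 2 from symmetrization and 16 from the
  -- tail bound.
  refine ⟨25600, by norm_num, ?_⟩
  intro 𝒴 Ω _ μ _ d 𝒳 h𝒳 p _ dist f G hdist V hV hG Q k order n hn X X' hX student hmem hmeas _
    δ hδ hδ1
  set q := Distill.gibbsLaw h𝒳 Q order p
  have hn0 : (0 : ℝ) < n := by exact_mod_cast hn
  -- The Gibbs kernels need no analysis: `q` is the law of a random variable, available because n >
  -- 0.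
  have hq : IsProbabilityMeasure q := by
    have hlaw := (hX.law_snd ⟨0, hn⟩).map_eq
    change _ = q at hlaw
    rw [← hlaw]
    exact Measure.isProbabilityMeasure_map (hX.law_snd ⟨0, hn⟩).aemeasurable
  -- The joint laws may differ with `i`; only their marginals `p` and `q` are common.
  let ν : Fin n → Measure (𝒳 × 𝒳) := fun i => μ.map fun ω => (X i ω, X' i ω)
  have hZi : ∀ i, AEMeasurable (fun ω => (X i ω, X' i ω)) μ := fun i =>
    (hX.law_fst i).aemeasurable.prodMk (hX.law_snd i).aemeasurable
  have hν : ∀ i, IsProbabilityMeasure (ν i) := fun i => Measure.isProbabilityMeasure_map (hZi i)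
  have hν1 : ∀ i, (ν i).map Prod.fst = p := fun i => by
    rw [AEMeasurable.map_map_of_aemeasurable measurable_fst.aemeasurable (hZi i)]
    exact (hX.law_fst i).map_eq
  have hν2 : ∀ i, (ν i).map Prod.snd = q := fun i => by
    rw [AEMeasurable.map_map_of_aemeasurable measurable_snd.aemeasurable (hZi i)]
    exact (hX.law_snd i).map_eq
  let Z : Ω → Fin n → 𝒳 × 𝒳 := fun ω i => (X i ω, X' i ω)
  have hZ : AEMeasurable Z μ := aemeasurable_pi_lambda _ hZi
  have hmap : μ.map Z = Measure.pi ν := (iIndepFun_iff_map_fun_eq_pi_map hZi).1 hX.indep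
  let h : (Fin n → 𝒳 × 𝒳) → 𝒳 → ℝ := fun z x =>
    dist (f x) (student (Sum.elim (fun i => (z i).1) fun i => (z i).2) x)
  have hh : Measurable (Function.uncurry h) := by
    refine hmeas.comp (Measurable.prodMk (measurable_pi_lambda _ fun i => ?_) measurable_snd)
    rcases i with i | i
    · exact measurable_fst.comp ((measurable_pi_apply i).comp measurable_fst)
    · exact measurable_snd.comp ((measurable_pi_apply i).comp measurable_fst)
  have h01 : ∀ z x, 0 ≤ h z x ∧ h z x ≤ 1 := fun z x => hdist _ (hmem _) x
  let φ : (Fin n → 𝒳 × 𝒳) → 𝒳 × 𝒳 → ℝ := fun z => Distill.pairMean (h z)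
  have hφ : Measurable (Function.uncurry φ) :=
    ((hh.comp (measurable_fst.prodMk (measurable_fst.comp measurable_snd))).add
      (hh.comp (measurable_fst.prodMk (measurable_snd.comp measurable_snd)))).div_const 2
  have hφ01 : ∀ z u, 0 ≤ φ z u ∧ φ z u ≤ 1 := fun z u => by
    have h1 := h01 z u.1
    have h2 := h01 z u.2
    simp only [φ, Distill.pairMean]
    constructor <;> linarith
  have hL : 0 ≤ -Real.log δ := by linarith [Real.log_nonpos hδ.le hδ1.le]
  have htail := Distill.measureReal_meanGap_gt_le ν hn hφ hφ01
    (fun x w => Distill.rademacher_pairMean_le hV hn hG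
      (by rintro _ ⟨g, hg, rfl⟩ x; exact hdist g hg x) x (fun s => h (w s))
      fun s => ⟨_, hmem _, rfl⟩) hL
  rw [neg_neg, Real.exp_log hδ, Distill.sqrt_gap_eq hn] at htail
  set r : ℝ := √((4 * V * 25600 + -Real.log δ) / n)
  have hbad : MeasurableSet {z | n * r < Distill.meanGap ν φ z} :=
    measurableSet_lt measurable_const (Distill.measurable_meanGap ν hφ)
  calc 1 - δ ≤ 1 - (Measure.pi ν).real {z | n * r < Distill.meanGap ν φ z} := by linarith
    _ = (Measure.pi ν).real {z | n * r < Distill.meanGap ν φ z}ᶜ :=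
        (probReal_compl_eq_one_sub hbad).symm
    _ = μ.real (Z ⁻¹' {z | n * r < Distill.meanGap ν φ z}ᶜ) := by
        rw [← hmap, map_measureReal_apply_of_aemeasurable hZ hbad.compl]
    _ ≤ _ := measureReal_mono fun ω hω => ?_
  have hgap : Distill.meanGap ν φ (Z ω) ≤ n * r := not_lt.1 hω
  have hm : Measurable (h (Z ω)) := hh.comp measurable_prodMk_left
  -- This gives D(p) ≤ (D(p) + D(q)) / 2 + Δ / 2, which is half of the allowed Δ.
  have htv := Distill.integral_le_integral_add_tvNorm q p hm (h01 _)
  have hemp := Distill.sum_elim_div_card (h (Z ω)) (X · ω) (X' · ω)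
  have hgap_eq : Distill.meanGap ν φ (Z ω)
      = n * ((∫ x, h (Z ω) x ∂p + ∫ x, h (Z ω) x ∂q) / 2)
        - n * ((∑ i, h (Z ω) (Sum.elim (X · ω) (X' · ω) i)) / Fintype.card (Fin n ⊕ Fin n)) := by
    rw [hemp, Distill.meanGap, Finset.sum_sub_distrib]
    congr 1
    rw [Finset.sum_congr rfl fun i _ =>
      Distill.integral_pairMean (hν1 i) (hν2 i) hm (h01 _)]
    simp
  rw [hgap_eq, ← mul_sub] at hgap
  have hgap' := le_of_mul_le_mul_left hgap hn0
  have hΔ := Distill.tvNorm_nonneg q p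
  have hr : r ≤ √((4 * V * (25600 + Distill.tvNorm q p) - Real.log δ) / n) := by
    apply Real.sqrt_le_sqrt
    gcongr
    have : 0 ≤ (V : ℝ) * Distill.tvNorm q p := by positivity
    linarith
  change ∫ x, h (Z ω) x ∂p ≤ (∑ i, h (Z ω) (Sum.elim (X · ω) (X' · ω) i)) /
    Fintype.card (Fin n ⊕ Fin n) + _ + _
  linarith
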